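/- Let $\mathcal V$ be a braided rigid monoidal category with tensor unit $\mathbb 1$ and braiding $\sigma$. Write ${}^\vee X$ for the left dual of $X$ (evaluation ${}^\vee X\otimes X\to\mathbb 1$) and $X^\vee$ for the right dual (evaluation $X\otimes X^\vee\to\mathbb 1$). Associators and unitors are suppressed, and composition is written from right to left. **The coend.** Suppose that the functor $(X,Y)\mapsto {}^\vee X\otimes Y$ has a coend $(C,\iota)$, and let $\delta_X\colon X\to X\otimes C$ be the natural transformation corresponding to $\iota_X\colon {}^\vee X\otimes X\to C$ (the universal coaction). Every natural family $X\to X\otimes D$ is $(X\otimes f)\delta_X$ for a unique $f\colon C\to D$, and every natural family $X\otimes Y\to X\otimes Y\otimes D$ is $(X\otimes Y\otimes f)(X\otimes\sigma_{C,Y}\otimes C)(\delta_X\otimes\delta_Y)$ for a unique $f\colon C\otimes C\to D$. Let $\Delta_C\colon C\to C\otimes C$, $u_C=\delta_{\mathbb 1}\colon\mathbb 1\to C$, $m_C\colon C\otimes C\to C$ and $\omega\colon C\otimes C\to\mathbb 1$ be the morphisms with $$(X\otimes\Delta_C)\delta_X=(\delta_X\otimes C)\delta_X,\qquad (X\otimes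 Y\otimes m_C)(X\otimes\sigma_{C,Y}\otimes C)(\delta_X\otimes\delta_Y)=\delta_{X\otimes Y},$$ $$(X\otimes Y\otimes\omega)(X\otimes\sigma_{C,Y}\otimes C)(\delta_X\otimes\delta_Y)=\sigma_{Y,X}\sigma_{X,Y}.$$ **The Hopf algebra and its modules.** Let $H$ be a Hopf algebra in $\mathcal V$ with product $m_H$, coproduct $\Delta_H$, counit $\epsilon_H$ and antipode $S$. Let $\mathcal V_H$ be the category of right $H$-modules $(M,r)$ in $\mathcal V$. It is monoidal: $H$ acts on $M\otimes N$ by $(r_M\otimes r_N)(M\otimes\sigma_{N,H}\otimes H)(M\otimes N\otimes\Delta_H)$ and on $\mathbb 1$ by $\epsilon_H$. The right dual of $M$ in $\mathcal V_H$ is $M^\vee$ with the action of $H$ determined by $$\mathrm{ev}\,(M\otimes r_{M^\vee})=\mathrm{ev}\,\bigl(r_M(M\otimes S)\otimes M^\vee\bigr)(M\otimes\sigma_{M^\vee,H}).$$ A pivotal structure on $\mathcal V_H$ is a natural transformation $\phi_M\colon M\to M^{\vee\vee}$ of functors $\mathcal V_H\to\mathcal V_H$ which is monoidal: $\phi_{M\otimes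 N}=\phi_M\otimes\phi_N$ and $\phi_{\mathbb 1}=\mathrm{id}$, up to the canonical isomorphisms $(M\otimes N)^{\vee\vee}\cong M^{\vee\vee}\otimes N^{\vee\vee}$ and $\mathbb 1^{\vee\vee}\cong\mathbb 1$. **$C$-pivotal elements.** Let $T\colon C\otimes C\to C\otimes C$ be the composite $$T=\sigma_{C,C}\,(C\otimes\omega\otimes C)\,(\sigma_{C,C}\otimes\sigma_{C,C})\,(C\otimes\sigma_{C,C}\otimes C)\,(\Delta_C\otimes\Delta_C).$$ (It satisfies $(X\otimes\sigma_{Y,C}\otimes C)(X\otimes Y\otimes T)(X\otimes\sigma_{C,Y}\otimes C)(\delta_X\otimes\delta_Y)=(\delta_X\otimes\delta_Y)\sigma_{Y,X}\sigma_{X,Y}$.) A morphism $p\colon C\to H$ is *$C$-twisted grouplike* if $$\Delta_H\,p\,m_C=(p\otimes p)\,T,\qquad \epsilon_H\,p\,u_C=\mathrm{id}_{\mathbb 1},$$ and it is a *$C$-pivotal element* of $H$ if it moreover satisfies the square-of-antipode axiom $$m_H\,(H\otimes p\,m_C)(\sigma_{C,H}\otimes C)(C\otimes\delta_H)=m_H\,(p\otimes\Omega_H)(\Delta_C\otimes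 S^2)\colon\ C\otimes H\to H,$$ where $\Omega_H=(H\otimes\omega)(\sigma_{C,H}\otimes C)(C\otimes\delta_H)\colon C\otimes H\to H$. Let $\mathsf{CPiv}(H)$ be the set of $C$-pivotal elements of $H$, and $\mathsf{Piv}(\mathcal V_H)$ the set of pivotal structures on $\mathcal V_H$. **Theorem.** The map $\Sigma\colon\mathrm{Hom}(C,H)\to\mathrm{Nat}(1_{\mathcal V},1_{\mathcal V}\otimes H)$, $\Sigma(p)_X=(X\otimes p)\delta_X$, is a bijection. For $a\in\mathrm{Nat}(1_{\mathcal V},1_{\mathcal V}\otimes H)$ let $a^\sharp_M=r_M\,a_M\colon M\to M$ for $(M,r_M)\in\mathcal V_H$, and let $\mu_X\colon X\to X^{\vee\vee}$ be the Drinfeld isomorphism of $\mathcal V$, $$\mu_X=(X^{\vee\vee}\otimes\mathrm{ev}_X)(X^{\vee\vee}\otimes\sigma_{X^\vee,X})(\mathrm{coev}_{X^\vee}\otimes X),\qquad \mathrm{coev}_{X^\vee}\colon\mathbb 1\to X^{\vee\vee}\otimes X^\vee,\quad \mathrm{ev}_X\colon X\otimes X^\vee\to\mathbb 1.$$ Then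 there is a bijection $$\mathsf{CPiv}(H)\;\cong\;\mathsf{Piv}(\mathcal V_H),\qquad p\longmapsto \mu\,\Sigma(p)^\sharp,$$ that is, $p$ is sent to the pivotal structure whose component at $(M,r_M)$ is $\mu_M\, r_M\,(M\otimes p)\,\delta_M$. -/

import Mathlib

open CategoryTheory MonoidalCategory
open scoped MonObj ComonObj HopfObj

universe v u

/-- A right module over a monoid object `H` of a monoidal category. -/
structure RightMod {V : Type u} [Category.{v} V] [MonoidalCategory V] (H : V) [MonObj H] where
  X : V
  act : X ⊗ H ⟶ X
  act_one : X ◁ η[H] ≫ act = (ρ_ X).hom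
  act_mul : X ◁ μ[H] ≫ act = (α_ X H H).inv ≫ act ▷ H ≫ act

namespace RightMod

section Category

variable {V : Type u} [Category.{v} V] [MonoidalCategory V] {H : V} [MonObj H]

/-- A morphism of right modules: an `H`-linear morphism of the underlying objects. -/
@[ext]
structure Hom (M N : RightMod H) where
  hom : M.X ⟶ N.X
  linear : M.act ≫ hom = hom ▷ H ≫ N.act

instance : Category (RightMod H) where
  Hom M N := Hom M N
  id M := ⟨𝟙 M.X, by simp⟩
  comp f g := ⟨f.hom ≫ g.hom, by rw [reassoc_of% f.linear, g.linear, comp_whiskerRight_assoc]⟩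

@[ext]
theorem hom_ext {M N : RightMod H} {f g : M ⟶ N} (h : f.hom = g.hom) : f = g := Hom.ext h

@[simp] theorem id_hom (M : RightMod H) : Hom.hom (𝟙 M) = 𝟙 M.X := rfl

@[simp]
theorem comp_hom {M N P : RightMod H} (f : M ⟶ N) (g : N ⟶ P) :
    (f ≫ g).hom = f.hom ≫ g.hom := rfl

/-- An isomorphism of modules from an `H`-linear isomorphism of the underlying objects. -/
def isoMk {M N : RightMod H} (e : M.X ≅ N.X) (h : M.act ≫ e.hom = e.hom ▷ H ≫ N.act) : M ≅ N where
  hom := ⟨e.hom, h⟩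
  inv := ⟨e.inv, by
    rw [Iso.comp_inv_eq, Category.assoc, h, inv_hom_whiskerRight_assoc]⟩
  hom_inv_id := by ext; simp
  inv_hom_id := by ext; simp

/-- The forgetful functor. -/
def forget (H : V) [MonObj H] : RightMod H ⥤ V where
  obj M := M.X
  map f := f.hom

end Category

section Monoidal

variable {V : Type u} [Category.{v} V] [MonoidalCategory V] [BraidedCategory V]
  {H : V} [BimonObj H]

/-- The diagonal action of `H` on a tensor product: apply the comultiplication of `H`, braid the
first copy of `H` past the second factor, and let the two copies act. -/
def diagAct {X Y : V} (r : X ⊗ H ⟶ X) (s : Y ⊗ H ⟶ Y) : (X ⊗ Y) ⊗ H ⟶ X ⊗ Y :=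
  (X ⊗ Y) ◁ Δ[H] ≫ tensorμ X Y H H ≫ (r ⊗ₘ s)

/-- The action of `H` on the unit object through the counit. -/
def unitAct (H : V) [BimonObj H] : 𝟙_ V ⊗ H ⟶ 𝟙_ V := (λ_ H).hom ≫ ε[H]

theorem diagAct_natural {X X' Y Y' : V} {r : X ⊗ H ⟶ X} {r' : X' ⊗ H ⟶ X'} {s : Y ⊗ H ⟶ Y}
    {s' : Y' ⊗ H ⟶ Y'} (f : X ⟶ X') (g : Y ⟶ Y') (hf : r ≫ f = f ▷ H ≫ r')
    (hg : s ≫ g = g ▷ H ≫ s') :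
    diagAct r s ≫ (f ⊗ₘ g) = (f ⊗ₘ g) ▷ H ≫ diagAct r' s' := by
  rw [diagAct, diagAct, ← whisker_exchange_assoc, tensorμ_natural_left_assoc]
  simp [hf, hg]

theorem diagAct_assoc {X Y Z : V} (r : X ⊗ H ⟶ X) (s : Y ⊗ H ⟶ Y) (t : Z ⊗ H ⟶ Z) :
    diagAct (diagAct r s) t ≫ (α_ X Y Z).hom = (α_ X Y Z).hom ▷ H ≫ diagAct r (diagAct s t) := by
  have e₁ : diagAct (diagAct r s) t = ((X ⊗ Y) ⊗ Z) ◁ (Δ[H] ≫ Δ[H] ▷ H) ≫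
      tensorμ (X ⊗ Y) Z (H ⊗ H) H ≫ tensorμ X Y H H ▷ (Z ⊗ H) ≫ ((r ⊗ₘ s) ⊗ₘ t) := by
    have h := tensorμ_natural_right (X ⊗ Y) Z Δ[H] (𝟙 H)
    rw [tensorHom_id] at h
    rw [MonoidalCategory.whiskerLeft_comp, Category.assoc, reassoc_of% h]
    simp only [diagAct, MonoidalCategory.tensorHom_def, comp_whiskerRight, Category.assoc,
      MonoidalCategory.whiskerLeft_id]
    monoidal
  have e₂ : diagAct r (diagAct s t) = (X ⊗ (Y ⊗ Z)) ◁ (Δ[H] ≫ H ◁ Δ[H]) ≫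
      tensorμ X (Y ⊗ Z) H (H ⊗ H) ≫ (X ⊗ H) ◁ tensorμ Y Z H H ≫ (r ⊗ₘ (s ⊗ₘ t)) := by
    have h := tensorμ_natural_right X (Y ⊗ Z) (𝟙 H) Δ[H]
    rw [id_tensorHom] at h
    rw [MonoidalCategory.whiskerLeft_comp, Category.assoc, reassoc_of% h]
    simp [diagAct, MonoidalCategory.tensorHom_def']
  have h := associator_monoidal X Y Z H H H
  rw [e₁, e₂, ComonObj.comul_assoc]
  simp only [Category.assoc, associator_naturality]
  rw [reassoc_of% h, MonoidalCategory.tensorHom_def (α_ X Y Z).hom]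
  simp only [MonoidalCategory.whiskerLeft_comp, Category.assoc]
  rw [whisker_exchange_assoc, whisker_exchange_assoc]

theorem diagAct_unit_left {X : V} (r : X ⊗ H ⟶ X) :
    diagAct (unitAct H) r ≫ (λ_ X).hom = (λ_ X).hom ▷ H ≫ r := by
  have h := leftUnitor_monoidal X H
  have h2 := tensorμ_natural_right (𝟙_ V) X ε[H] (𝟙 H)
  have e : (unitAct H ⊗ₘ r) ≫ (λ_ X).hom =
      (𝟙_ V ◁ ε[H] ⊗ₘ X ◁ 𝟙 H) ≫ (λ_ (𝟙_ V)).hom ▷ (X ⊗ H) ≫ (λ_ (X ⊗ H)).hom ≫ r := by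
    simp [unitAct, MonoidalCategory.tensorHom_def]
  rw [diagAct, Category.assoc, Category.assoc, e, ← reassoc_of% h2, ← reassoc_of% h]
  rw [tensorHom_id, ← MonoidalCategory.whiskerLeft_comp_assoc, ComonObj.counit_comul,
    MonoidalCategory.tensorHom_def']
  simp

theorem diagAct_unit_right {X : V} (r : X ⊗ H ⟶ X) :
    diagAct r (unitAct H) ≫ (ρ_ X).hom = (ρ_ X).hom ▷ H ≫ r := by
  have h := rightUnitor_monoidal X H
  have h2 := tensorμ_natural_right X (𝟙_ V) (𝟙 H) ε[H]
  have e : (r ⊗ₘ unitAct H) ≫ (ρ_ X).hom =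
      (X ◁ 𝟙 H ⊗ₘ 𝟙_ V ◁ ε[H]) ≫ (X ⊗ H) ◁ (λ_ (𝟙_ V)).hom ≫ (ρ_ (X ⊗ H)).hom ≫ r := by
    simp [unitAct, MonoidalCategory.tensorHom_def']
  rw [diagAct, Category.assoc, Category.assoc, e, ← reassoc_of% h2, ← reassoc_of% h]
  rw [id_tensorHom, ← MonoidalCategory.whiskerLeft_comp_assoc, ComonObj.comul_counit,
    MonoidalCategory.tensorHom_def]
  simp

/-- The tensor product of right modules. -/
def tensorObj (M N : RightMod H) : RightMod H where
  X := M.X ⊗ N.X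
  act := diagAct M.act N.act
  act_one := by
    have h : η[H ⊗ H] = (λ_ (𝟙_ V)).inv ≫ (η[H] ⊗ₘ η[H]) := rfl
    rw [diagAct, ← MonoidalCategory.whiskerLeft_comp_assoc, BimonObj.one_comul, h,
      MonoidalCategory.whiskerLeft_comp_assoc,
      tensorμ_natural_right_assoc, tensorHom_comp_tensorHom, act_one, act_one,
      ← tensor_right_unitality]
  act_mul := by
    rw [diagAct, ← MonoidalCategory.whiskerLeft_comp_assoc, BimonObj.mul_comul]
    simp only [MonoidalCategory.whiskerLeft_comp, Category.assoc]
    rw [tensorμ_natural_right_assoc, tensorHom_comp_tensorHom, act_mul, act_mul]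
    have h := tensor_associativity M.X N.X H H H H
    rw [← Iso.inv_comp_eq] at h
    rw [← reassoc_of% h]
    simp only [tensorHom_comp_tensorHom, Iso.hom_inv_id_assoc, comp_whiskerRight, Category.assoc]
    have e : (M.act ⊗ₘ N.act) ▷ H ≫ (M.X ⊗ N.X) ◁ Δ[H] ≫ tensorμ M.X N.X H H =
        ((M.X ⊗ H) ⊗ (N.X ⊗ H)) ◁ Δ[H] ≫ tensorμ (M.X ⊗ H) (N.X ⊗ H) H H ≫
          (M.act ▷ H ⊗ₘ N.act ▷ H) := by
      rw [← whisker_exchange_assoc, tensorμ_natural_left]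
    rw [reassoc_of% e, tensorHom_comp_tensorHom, ← whisker_exchange_assoc]
    simp only [← Category.assoc]
    congr 3
    rw [MonoidalCategory.tensorHom_def]
    monoidal

/-- The unit module. -/
def unitObj (H : V) [BimonObj H] : RightMod H where
  X := 𝟙_ V
  act := unitAct H
  act_one := by
    rw [unitAct, leftUnitor_naturality_assoc, BimonObj.one_counit, Category.comp_id, unitors_equal]
  act_mul := by
    have h : ε[H ⊗ H] = (ε[H] ⊗ₘ ε[H]) ≫ (λ_ (𝟙_ V)).hom := rfl
    rw [unitAct, leftUnitor_naturality_assoc, BimonObj.mul_counit, h,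
      MonoidalCategory.tensorHom_def]
    monoidal

instance : MonoidalCategoryStruct (RightMod H) where
  tensorObj := tensorObj
  whiskerLeft M _ _ f := ⟨M.X ◁ f.hom, by
    have h := diagAct_natural (r := M.act) (r' := M.act) (𝟙 M.X) f.hom (by simp) f.linear
    rwa [id_tensorHom] at h⟩
  whiskerRight f N := ⟨f.hom ▷ N.X, by
    have h := diagAct_natural (s := N.act) (s' := N.act) f.hom (𝟙 N.X) f.linear (by simp)
    rwa [tensorHom_id] at h⟩
  tensorHom f g := ⟨f.hom ⊗ₘ g.hom, diagAct_natural f.hom g.hom f.linear g.linear⟩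
  tensorUnit := unitObj H
  associator M N P := isoMk (α_ M.X N.X P.X) (diagAct_assoc M.act N.act P.act)
  leftUnitor M := isoMk (λ_ M.X) (diagAct_unit_left M.act)
  rightUnitor M := isoMk (ρ_ M.X) (diagAct_unit_right M.act)

instance : MonoidalCategory (RightMod H) where
  tensorHom_def f g := hom_ext (MonoidalCategory.tensorHom_def f.hom g.hom)
  id_tensorHom_id M N := hom_ext (id_tensorHom_id M.X N.X)
  tensorHom_comp_tensorHom f g h k :=
    hom_ext (tensorHom_comp_tensorHom f.hom g.hom h.hom k.hom)
  whiskerLeft_id M N := hom_ext (MonoidalCategory.whiskerLeft_id M.X N.X)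
  id_whiskerRight M N := hom_ext (MonoidalCategory.id_whiskerRight M.X N.X)
  associator_naturality f g h := hom_ext (associator_naturality f.hom g.hom h.hom)
  leftUnitor_naturality f := hom_ext (leftUnitor_naturality f.hom)
  rightUnitor_naturality f := hom_ext (rightUnitor_naturality f.hom)
  pentagon M N P Q := hom_ext (MonoidalCategory.pentagon M.X N.X P.X Q.X)
  triangle M N := hom_ext (MonoidalCategory.triangle M.X N.X)

end Monoidal

section Dual

variable {V : Type u} [Category.{v} V] [MonoidalCategory V]

open ExactPairing

theorem dual_hom_ext {X N : V} [ExactPairing N X] {A : V} {f g : A ⟶ N}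
    (h : X ◁ f ≫ ε_ N X = X ◁ g ≫ ε_ N X) : f = g := by
  have h2 : f ≫ (ρ_ N).inv = g ≫ (ρ_ N).inv := by
    apply (tensorLeftHomEquiv A N X (𝟙_ V)).symm.injective
    simp only [tensorLeftHomEquiv, Equiv.coe_fn_symm_mk]
    have key : ∀ k : A ⟶ N, X ◁ (k ≫ (ρ_ N).inv) ≫ (α_ _ _ _).inv ≫ ε_ N X ▷ 𝟙_ V ≫
        (λ_ (𝟙_ V)).hom = X ◁ k ≫ ε_ N X := by
      intro k
      simp [unitors_equal]
    rw [key, key, h]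
  simpa using h2

variable [BraidedCategory V] {H : V} [HopfObj H]

/-- The action of `H` on `X` precomposed with the antipode. -/
def antipodeAct {X : V} (r : X ⊗ H ⟶ X) : X ⊗ H ⟶ X := X ◁ 𝒮[H] ≫ r

/-- The pairing `x ⊗ f ⊗ h ↦ f (x · S h)`, where `H` is braided past the dual. -/
def dualPairing {X : V} (N : V) [ExactPairing N X] (r : X ⊗ H ⟶ X) : X ⊗ (N ⊗ H) ⟶ 𝟙_ V :=
  X ◁ (β_ N H).hom ≫ (α_ X H N).inv ≫ antipodeAct r ▷ N ≫ ε_ N X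

/-- The action of `H` on a dual `N` of `X`: the transpose of `dualPairing`. -/
def dualAct {X : V} (N : V) [ExactPairing N X] (r : X ⊗ H ⟶ X) : N ⊗ H ⟶ N :=
  tensorLeftHomEquiv (N ⊗ H) N X (𝟙_ V) (dualPairing N r) ≫ (ρ_ N).hom

theorem dualAct_evaluation {X : V} (N : V) [ExactPairing N X] (r : X ⊗ H ⟶ X) :
    X ◁ dualAct N r ≫ ε_ N X = dualPairing N r := by
  have h := (tensorLeftHomEquiv (N ⊗ H) N X (𝟙_ V)).left_inv (dualPairing N r)
  rw [← h]
  simp [tensorLeftHomEquiv, dualAct, unitors_equal]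

theorem antipodeAct_one (M : RightMod H) : M.X ◁ η[H] ≫ antipodeAct M.act = (ρ_ M.X).hom := by
  rw [antipodeAct, ← MonoidalCategory.whiskerLeft_comp_assoc, HopfObj.one_antipode, M.act_one]

theorem antipodeAct_mul (M : RightMod H) : M.X ◁ μ[H] ≫ antipodeAct M.act =
    M.X ◁ (β_ H H).hom ≫ (α_ M.X H H).inv ≫ antipodeAct M.act ▷ H ≫ antipodeAct M.act := by
  rw [antipodeAct, ← MonoidalCategory.whiskerLeft_comp_assoc, HopfObj.mul_antipode,
    BraidedCategory.braiding_naturality_assoc]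
  simp only [MonoidalCategory.whiskerLeft_comp, Category.assoc, M.act_mul]
  rw [MonoidalCategory.tensorHom_def, comp_whiskerRight, Category.assoc, ← whisker_exchange_assoc]
  monoidal

/-- The dual of a right module. -/
def dualObj (M : RightMod H) (N : V) [ExactPairing N M.X] : RightMod H where
  X := N
  act := dualAct N M.act
  act_one := by
    apply dual_hom_ext (X := M.X)
    rw [MonoidalCategory.whiskerLeft_comp, Category.assoc, dualAct_evaluation, dualPairing]
    calc
      _ = M.X ◁ (N ◁ η[H] ≫ (β_ N H).hom) ⊗≫ antipodeAct M.act ▷ N ≫ ε_ N M.X := by monoidal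
      _ = M.X ◁ (β_ N (𝟙_ V)).hom ⊗≫ (M.X ◁ η[H] ≫ antipodeAct M.act) ▷ N ≫ ε_ N M.X := by
        rw [BraidedCategory.braiding_naturality_right]; monoidal
      _ = _ := by
        rw [antipodeAct_one, braiding_tensorUnit_right]; monoidal
  act_mul := by
    apply dual_hom_ext (X := M.X)
    have e : M.X ◁ dualAct N M.act ▷ H ≫ dualPairing N M.act =
        M.X ◁ (β_ (N ⊗ H) H).hom ⊗≫ antipodeAct M.act ▷ (N ⊗ H) ⊗≫ dualPairing N M.act := by
      calc
        _ = M.X ◁ (dualAct N M.act ▷ H ≫ (β_ N H).hom) ⊗≫ antipodeAct M.act ▷ N ≫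
            ε_ N M.X := by rw [dualPairing]; monoidal
        _ = M.X ◁ (β_ (N ⊗ H) H).hom ⊗≫ ((M.X ⊗ H) ◁ dualAct N M.act ≫
            antipodeAct M.act ▷ N) ≫ ε_ N M.X := by
          rw [BraidedCategory.braiding_naturality_left]; monoidal
        _ = M.X ◁ (β_ (N ⊗ H) H).hom ⊗≫ antipodeAct M.act ▷ (N ⊗ H) ≫
            (M.X ◁ dualAct N M.act ≫ ε_ N M.X) := by
          rw [whisker_exchange]; monoidal
        _ = _ := by rw [dualAct_evaluation]; monoidal
    simp only [MonoidalCategory.whiskerLeft_comp, Category.assoc, dualAct_evaluation]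
    rw [e, dualPairing]
    calc
      _ = M.X ◁ (N ◁ μ[H] ≫ (β_ N H).hom) ⊗≫ antipodeAct M.act ▷ N ≫ ε_ N M.X := by monoidal
      _ = M.X ◁ (β_ N (H ⊗ H)).hom ⊗≫ (M.X ◁ μ[H] ≫ antipodeAct M.act) ▷ N ≫ ε_ N M.X := by
        rw [BraidedCategory.braiding_naturality_right]; monoidal
      _ = M.X ◁ ((β_ N (H ⊗ H)).hom ≫ (β_ H H).hom ▷ N) ⊗≫
          (antipodeAct M.act ▷ H ≫ antipodeAct M.act) ▷ N ≫ ε_ N M.X := by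
        rw [antipodeAct_mul]; monoidal
      _ = M.X ◁ (N ◁ (β_ H H).hom ≫ (β_ N (H ⊗ H)).hom) ⊗≫
          (antipodeAct M.act ▷ H ≫ antipodeAct M.act) ▷ N ≫ ε_ N M.X := by
        rw [← BraidedCategory.braiding_naturality_right]
      _ = M.X ◁ (N ◁ (β_ H H).hom ⊗≫ (β_ N H).hom ▷ H) ⊗≫ ((M.X ⊗ H) ◁ (β_ N H).hom ≫
          antipodeAct M.act ▷ (H ⊗ N)) ⊗≫ antipodeAct M.act ▷ N ≫ ε_ N M.X := by
        rw [BraidedCategory.braiding_tensor_right_hom]; monoidal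
      _ = _ := by
        rw [whisker_exchange, BraidedCategory.braiding_tensor_left_hom]; monoidal

theorem dual_evaluation_linear (M : RightMod H) (N : V) [ExactPairing N M.X] :
    diagAct M.act (dualAct N M.act) ≫ ε_ N M.X = ε_ N M.X ▷ H ≫ unitAct H := by
  have e : M.act ▷ H ≫ antipodeAct M.act =
      (α_ M.X H H).hom ≫ M.X ◁ (H ◁ 𝒮[H] ≫ μ[H]) ≫ M.act := by
    rw [antipodeAct, MonoidalCategory.whiskerLeft_comp, Category.assoc, M.act_mul,
      ← whisker_exchange_assoc]
    monoidal
  calc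
    _ = (M.X ⊗ N) ◁ Δ[H] ⊗≫ M.X ◁ (β_ N H).hom ▷ H ⊗≫ M.act ▷ (N ⊗ H) ≫
        (M.X ◁ dualAct N M.act ≫ ε_ N M.X) := by
      rw [diagAct, tensorμ, MonoidalCategory.tensorHom_def]; monoidal
    _ = (M.X ⊗ N) ◁ Δ[H] ⊗≫ M.X ◁ (β_ N H).hom ▷ H ⊗≫ (M.act ▷ (N ⊗ H) ≫
        M.X ◁ (β_ N H).hom) ⊗≫ antipodeAct M.act ▷ N ≫ ε_ N M.X := by
      rw [dualAct_evaluation, dualPairing]; monoidal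
    _ = 𝟙 _ ⊗≫ M.X ◁ (N ◁ Δ[H] ≫ (β_ N (H ⊗ H)).hom) ⊗≫ (M.act ▷ H ≫ antipodeAct M.act) ▷ N ≫
        ε_ N M.X := by
      rw [← whisker_exchange, BraidedCategory.braiding_tensor_right_hom]; monoidal
    _ = 𝟙 _ ⊗≫ M.X ◁ (β_ N H).hom ⊗≫ (M.X ◁ (Δ[H] ≫ H ◁ 𝒮[H] ≫ μ[H]) ≫ M.act) ▷ N ≫ ε_ N M.X := by
      rw [e, BraidedCategory.braiding_naturality_right]; monoidal
    _ = 𝟙 _ ⊗≫ M.X ◁ ((β_ N H).hom ≫ ε[H] ▷ N) ⊗≫ (M.X ◁ η[H] ≫ M.act) ▷ N ≫ ε_ N M.X := by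
      rw [HopfObj.antipode_right]; monoidal
    _ = 𝟙 _ ⊗≫ ((M.X ⊗ N) ◁ ε[H] ≫ ε_ N M.X ▷ 𝟙_ V) ⊗≫ 𝟙 _ := by
      rw [M.act_one, ← BraidedCategory.braiding_naturality_right, braiding_tensorUnit_right]
      monoidal
    _ = _ := by
      rw [whisker_exchange, unitAct]; monoidal

theorem dual_coevaluation_linear (M : RightMod H) (N : V) [ExactPairing N M.X] :
    unitAct H ≫ η_ N M.X = η_ N M.X ▷ H ≫ diagAct (dualAct N M.act) M.act := by
  have e : antipodeAct M.act ▷ H ≫ M.act =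
      (α_ M.X H H).hom ≫ M.X ◁ (𝒮[H] ▷ H ≫ μ[H]) ≫ M.act := by
    rw [antipodeAct, MonoidalCategory.whiskerLeft_comp, Category.assoc, M.act_mul]
    monoidal
  apply (tensorLeftHomEquiv (𝟙_ V ⊗ H) N M.X M.X).symm.injective
  simp only [tensorLeftHomEquiv, Equiv.coe_fn_symm_mk]
  symm
  calc
    _ = M.X ◁ (η_ N M.X ▷ H ≫ (N ⊗ M.X) ◁ Δ[H]) ⊗≫ M.X ◁ N ◁ (β_ M.X H).hom ▷ H ⊗≫
        (M.X ◁ dualAct N M.act ≫ ε_ N M.X) ▷ (M.X ⊗ H) ⊗≫ M.act := by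
      rw [diagAct, tensorμ, MonoidalCategory.tensorHom_def]
      calc
        _ = M.X ◁ (η_ N M.X ▷ H ≫ (N ⊗ M.X) ◁ Δ[H]) ⊗≫ M.X ◁ N ◁ (β_ M.X H).hom ▷ H ⊗≫
          (M.X ◁ dualAct N M.act) ▷ (M.X ⊗ H) ⊗≫ ((M.X ⊗ N) ◁ M.act ≫ ε_ N M.X ▷ M.X) ⊗≫
            𝟙 _ := by monoidal
        _ = _ := by rw [whisker_exchange]; monoidal
    _ = 𝟙 _ ⊗≫ M.X ◁ Δ[H] ⊗≫ M.X ◁ (η_ N M.X ▷ H ≫ (β_ (N ⊗ M.X) H).hom) ▷ H ⊗≫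
        antipodeAct M.act ▷ (N ⊗ M.X ⊗ H) ⊗≫ ε_ N M.X ▷ (M.X ⊗ H) ⊗≫ M.act := by
      rw [← whisker_exchange, dualAct_evaluation, dualPairing,
        BraidedCategory.braiding_tensor_left_hom]
      monoidal
    _ = 𝟙 _ ⊗≫ M.X ◁ Δ[H] ⊗≫ ((M.X ⊗ H) ◁ η_ N M.X ≫
        antipodeAct M.act ▷ (N ⊗ M.X)) ▷ H ⊗≫ ε_ N M.X ▷ (M.X ⊗ H) ⊗≫ M.act := by
      rw [BraidedCategory.braiding_naturality_left, braiding_tensorUnit_left]; monoidal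
    _ = 𝟙 _ ⊗≫ M.X ◁ Δ[H] ⊗≫ antipodeAct M.act ▷ H ⊗≫
        (M.X ◁ η_ N M.X ⊗≫ ε_ N M.X ▷ M.X) ▷ H ⊗≫ M.act := by
      rw [whisker_exchange]; monoidal
    _ = 𝟙 _ ⊗≫ M.X ◁ Δ[H] ⊗≫ (antipodeAct M.act ▷ H ≫ M.act) := by
      rw [coevaluation_evaluation'']; monoidal
    _ = 𝟙 _ ⊗≫ M.X ◁ (Δ[H] ≫ 𝒮[H] ▷ H ≫ μ[H]) ≫ M.act := by
      rw [e]; monoidal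
    _ = 𝟙 _ ⊗≫ M.X ◁ ε[H] ≫ (M.X ◁ η[H] ≫ M.act) := by
      rw [HopfObj.antipode_left]; monoidal
    _ = 𝟙 _ ⊗≫ M.X ◁ ε[H] ⊗≫ (M.X ◁ η_ N M.X ⊗≫ ε_ N M.X ▷ M.X) ⊗≫ 𝟙 _ := by
      rw [coevaluation_evaluation'', M.act_one]; monoidal
    _ = _ := by rw [unitAct]; monoidal

/-- The duality pairing of `dualObj M N` and `M`. -/
instance dualPairingModule (M : RightMod H) (N : V) [ExactPairing N M.X] :
    ExactPairing (dualObj M N) M where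
  coevaluation' := ⟨η_ N M.X, dual_coevaluation_linear M N⟩
  evaluation' := ⟨ε_ N M.X, dual_evaluation_linear M N⟩
  coevaluation_evaluation' := hom_ext (coevaluation_evaluation N M.X)
  evaluation_coevaluation' := hom_ext (evaluation_coevaluation N M.X)

instance leftRigid [LeftRigidCategory V] : LeftRigidCategory (RightMod H) where
  leftDual M := { leftDual := dualObj M (HasLeftDual.leftDual M.X) }

end Dual
end RightMod

section Pivotal

variable (C : Type u) [Category.{v} C] [MonoidalCategory C] [LeftRigidCategory C]

/-- The double dual functor `X ↦ ᘁᘁX`. -/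
def doubleDual : C ⥤ C where
  obj X := ᘁ(ᘁX)
  map f := ᘁ(ᘁf)
  map_id X := by rw [leftAdjointMate_id, leftAdjointMate_id]
  map_comp f g := by rw [comp_leftAdjointMate, comp_leftAdjointMate]

variable {C}

/-- If `Y` is a dual of `X` and `Z` is a dual of `Y`, the canonical isomorphism from the double
dual of `X` to `Z`. -/
def doubleDualIso (X Y Z : C) [ExactPairing Y X] [ExactPairing Z Y] :
    (doubleDual C).obj X ≅ Z :=
  letI i : (ᘁX : C) ≅ Y := leftDualIso HasLeftDual.exact inferInstance
  leftDualIso (@exactPairingCongrRight C _ _ (ᘁ(ᘁX)) Y (ᘁX) HasLeftDual.exact i.symm)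
    inferInstance

/-- The canonical isomorphism from the double dual of `X ⊗ Y`. -/
def doubleDualTensorIso (X Y : C) :
    (doubleDual C).obj (X ⊗ Y) ≅ (doubleDual C).obj X ⊗ (doubleDual C).obj Y :=
  doubleDualIso (X ⊗ Y) ((ᘁY : C) ⊗ (ᘁX : C)) ((ᘁ(ᘁX) : C) ⊗ (ᘁ(ᘁY) : C))

variable (C) in
/-- The canonical isomorphism from the double dual of the unit object. -/
def doubleDualUnitIso : (doubleDual C).obj (𝟙_ C) ≅ 𝟙_ C :=
  doubleDualIso (𝟙_ C) (𝟙_ C) (𝟙_ C)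

variable (C) in
/-- A pivotal structure: a monoidal natural transformation from the identity functor to the
double dual functor. -/
@[ext]
structure PivotalStructure where
  toNatTrans : 𝟭 C ⟶ doubleDual C
  tensor : ∀ X Y : C, toNatTrans.app (X ⊗ Y) ≫ (doubleDualTensorIso X Y).hom =
    (toNatTrans.app X ⊗ₘ toNatTrans.app Y)
  unit : toNatTrans.app (𝟙_ C) ≫ (doubleDualUnitIso C).hom = 𝟙 (𝟙_ C)

/-- The Drinfeld morphism `X ⟶ ᘁᘁX`. -/
def drinfeld [BraidedCategory C] (X : C) : X ⟶ (doubleDual C).obj X :=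
  (λ_ X).inv ≫ η_ (ᘁ(ᘁX)) (ᘁX) ▷ X ≫ (α_ (ᘁ(ᘁX)) (ᘁX) X).hom ≫
    (ᘁ(ᘁX)) ◁ (β_ (ᘁX) X).hom ≫ (ᘁ(ᘁX)) ◁ ε_ (ᘁX) X ≫ (ρ_ (ᘁ(ᘁX))).hom

end Pivotal

section Coend

variable (V : Type u) [Category.{v} V] [MonoidalCategory V] [RightRigidCategory V]

/-- The functor `(X, Y) ↦ Xᘁ ⊗ Y`. -/
def dualTensor : Vᵒᵖ ⥤ V ⥤ V where
  obj X := tensorLeft (X.unopᘁ)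
  map f := (tensoringLeft V).map (f.unopᘁ)
  map_id X := by simp [rightAdjointMate_id]
  map_comp f g := by simp [comp_rightAdjointMate]

variable {V} (C : Limits.Cowedge (dualTensor V))

/-- The universal dinatural transformation of the coend. -/
def coendι (X : V) : Xᘁ ⊗ X ⟶ C.pt := C.π X

theorem coendι_dinatural {X Y : V} (f : X ⟶ Y) :
    (fᘁ : (Yᘁ : V) ⟶ (Xᘁ : V)) ▷ X ≫ coendι C X = (Yᘁ : V) ◁ f ≫ coendι C Y :=
  Limits.Cowedge.condition C f

/-- The universal coaction `X ⟶ X ⊗ C`. -/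
def coaction (X : V) : X ⟶ X ⊗ C.pt :=
  (λ_ X).inv ≫ η_ X Xᘁ ▷ X ≫ (α_ X Xᘁ X).hom ≫ X ◁ coendι C X

theorem coaction_natural {X Y : V} (f : X ⟶ Y) :
    f ≫ coaction C Y = coaction C X ≫ f ▷ C.pt := by
  have h2 := coevaluation_comp_rightAdjointMate f
  symm
  calc
    _ = (λ_ X).inv ≫ η_ X Xᘁ ▷ X ⊗≫ (X ◁ coendι C X ≫ f ▷ C.pt) := by
      rw [coaction]; monoidal
    _ = (λ_ X).inv ≫ (η_ X Xᘁ ≫ f ▷ Xᘁ) ▷ X ⊗≫ Y ◁ coendι C X := by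
      rw [whisker_exchange]; monoidal
    _ = (λ_ X).inv ≫ η_ Y Yᘁ ▷ X ⊗≫ Y ◁ (fᘁ ▷ X ≫ coendι C X) := by
      rw [← h2]; monoidal
    _ = (λ_ X).inv ≫ (η_ Y Yᘁ ▷ X ≫ (Y ⊗ Yᘁ) ◁ f) ⊗≫ Y ◁ coendι C Y := by
      rw [coendι_dinatural]; monoidal
    _ = _ := by
      rw [← whisker_exchange, coaction]; monoidal

variable {C} (hC : Limits.IsColimit C)

/-- The morphism `Xᘁ ⊗ X ⟶ D` which is the transpose of `k : X ⟶ X ⊗ D`. -/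
def evalTranspose {X D : V} (k : X ⟶ X ⊗ D) : (Xᘁ : V) ⊗ X ⟶ D :=
  (Xᘁ : V) ◁ k ≫ (α_ (Xᘁ : V) X D).inv ≫ ε_ X (Xᘁ : V) ▷ D ≫ (λ_ D).hom

theorem evalTranspose_dinatural {X Y D : V} (f : X ⟶ Y) (a : X ⟶ X ⊗ D) (b : Y ⟶ Y ⊗ D)
    (h : f ≫ b = a ≫ f ▷ D) :
    (fᘁ : (Yᘁ : V) ⟶ (Xᘁ : V)) ▷ X ≫ evalTranspose a = (Yᘁ : V) ◁ f ≫ evalTranspose b := by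
  have h2 := rightAdjointMate_comp_evaluation f
  calc
    _ = ((fᘁ : (Yᘁ : V) ⟶ (Xᘁ : V)) ▷ X ≫ (Xᘁ : V) ◁ a) ⊗≫ ε_ X (Xᘁ : V) ▷ D ⊗≫ 𝟙 _ := by
      rw [evalTranspose]; monoidal
    _ = (Yᘁ : V) ◁ a ⊗≫ ((fᘁ : (Yᘁ : V) ⟶ (Xᘁ : V)) ▷ X ≫ ε_ X (Xᘁ : V)) ▷ D ⊗≫ 𝟙 _ := by
      rw [← whisker_exchange]; monoidal
    _ = (Yᘁ : V) ◁ (a ≫ f ▷ D) ⊗≫ ε_ Y (Yᘁ : V) ▷ D ⊗≫ 𝟙 _ := by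
      rw [h2]; monoidal
    _ = _ := by
      rw [← h, evalTranspose]; monoidal

/-- The morphism `C ⟶ D` induced by a natural family `X ⟶ X ⊗ D`. -/
def coendDesc {D : V} (a : ∀ X : V, X ⟶ X ⊗ D)
    (ha : ∀ {X Y : V} (f : X ⟶ Y), f ≫ a Y = a X ≫ f ▷ D) : C.pt ⟶ D :=
  Limits.Cowedge.IsColimit.desc hC (fun X => evalTranspose (a X))
    (fun _ _ f => evalTranspose_dinatural f _ _ (ha f))

theorem coaction_coendDesc {D : V} (a : ∀ X : V, X ⟶ X ⊗ D)
    (ha : ∀ {X Y : V} (f : X ⟶ Y), f ≫ a Y = a X ≫ f ▷ D) (X : V) :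
    coaction C X ≫ X ◁ coendDesc hC a ha = a X := by
  have h : coendι C X ≫ coendDesc hC a ha =
      Xᘁ ◁ a X ≫ (α_ Xᘁ X D).inv ≫ ε_ X Xᘁ ▷ D ≫ (λ_ D).hom :=
    Limits.Cowedge.IsColimit.π_desc hC _ _ X
  calc
    _ = (λ_ X).inv ≫ η_ X Xᘁ ▷ X ⊗≫ X ◁ (coendι C X ≫ coendDesc hC a ha) := by
      rw [coaction]; monoidal
    _ = 𝟙 _ ⊗≫ (η_ X Xᘁ ▷ X ≫ (X ⊗ Xᘁ) ◁ a X) ⊗≫ X ◁ ε_ X Xᘁ ▷ D ⊗≫ 𝟙 _ := by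
      rw [h]; monoidal
    _ = a X ⊗≫ (η_ X Xᘁ ▷ X ⊗≫ X ◁ ε_ X Xᘁ) ▷ D ⊗≫ 𝟙 _ := by
      rw [← whisker_exchange]; monoidal
    _ = _ := by
      rw [ExactPairing.evaluation_coevaluation'']; monoidal

theorem coend_hom_ext (hC : Limits.IsColimit C) {D : V} {f g : C.pt ⟶ D}
    (h : ∀ X, coaction C X ≫ X ◁ f = coaction C X ≫ X ◁ g) : f = g := by
  apply Limits.Cowedge.IsColimit.hom_ext hC
  have key : ∀ (k : C.pt ⟶ D) (X : V),
      coendι C X ≫ k = evalTranspose (coaction C X ≫ X ◁ k) := by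
    intro k X
    symm
    calc
      _ = 𝟙 _ ⊗≫ (Xᘁ : V) ◁ η_ X (Xᘁ : V) ▷ X ⊗≫ (((Xᘁ : V) ⊗ X) ◁ (coendι C X ≫ k) ≫
          ε_ X (Xᘁ : V) ▷ D) ⊗≫ 𝟙 _ := by
        rw [evalTranspose, coaction]; monoidal
      _ = 𝟙 _ ⊗≫ ((Xᘁ : V) ◁ η_ X (Xᘁ : V) ⊗≫ ε_ X (Xᘁ : V) ▷ (Xᘁ : V)) ▷ X ⊗≫
          (coendι C X ≫ k) ⊗≫ 𝟙 _ := by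
        rw [whisker_exchange]; monoidal
      _ = _ := by
        rw [ExactPairing.coevaluation_evaluation'']; monoidal
  intro X
  exact (key f X).trans ((congrArg evalTranspose (h X)).trans (key g X).symm)

/-- The family `X ⟶ X ⊗ (D ⊗ Aᘁ)` which is the transpose of a family `X ⊗ A ⟶ X ⊗ D`. -/
def transposeFamily {A D : V} (a : ∀ X : V, X ⊗ A ⟶ X ⊗ D) (X : V) : X ⟶ X ⊗ (D ⊗ Aᘁ) :=
  (ρ_ X).inv ≫ X ◁ η_ A Aᘁ ≫ (α_ X A Aᘁ).inv ≫ a X ▷ Aᘁ ≫ (α_ X D Aᘁ).hom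

theorem transposeFamily_natural {A D : V} (a : ∀ X : V, X ⊗ A ⟶ X ⊗ D)
    (ha : ∀ {X Y : V} (f : X ⟶ Y), f ▷ A ≫ a Y = a X ≫ f ▷ D) {X Y : V} (f : X ⟶ Y) :
    f ≫ transposeFamily a Y = transposeFamily a X ≫ f ▷ (D ⊗ Aᘁ) := by
  symm
  calc
    _ = 𝟙 _ ⊗≫ X ◁ η_ A Aᘁ ⊗≫ (a X ≫ f ▷ D) ▷ Aᘁ ⊗≫ 𝟙 _ := by rw [transposeFamily]; monoidal
    _ = 𝟙 _ ⊗≫ (X ◁ η_ A Aᘁ ≫ f ▷ (A ⊗ Aᘁ)) ⊗≫ a Y ▷ Aᘁ ⊗≫ 𝟙 _ := by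
      rw [← ha]; monoidal
    _ = _ := by
      rw [whisker_exchange, transposeFamily]; monoidal

/-- The morphism `C ⊗ A ⟶ D` induced by a natural family `X ⊗ A ⟶ X ⊗ D`. -/
def coendLift {A D : V} (a : ∀ X : V, X ⊗ A ⟶ X ⊗ D)
    (ha : ∀ {X Y : V} (f : X ⟶ Y), f ▷ A ≫ a Y = a X ≫ f ▷ D) : C.pt ⊗ A ⟶ D :=
  (tensorRightHomEquiv C.pt A Aᘁ D).symm
    (coendDesc hC (transposeFamily a) (transposeFamily_natural a ha))

theorem coaction_coendLift {A D : V} (a : ∀ X : V, X ⊗ A ⟶ X ⊗ D)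
    (ha : ∀ {X Y : V} (f : X ⟶ Y), f ▷ A ≫ a Y = a X ≫ f ▷ D) (X : V) :
    coaction C X ▷ A ≫ (α_ X C.pt A).hom ≫ X ◁ coendLift hC a ha = a X := by
  calc
    _ = (coaction C X ≫ X ◁ coendDesc hC (transposeFamily a) (transposeFamily_natural a ha)) ▷ A ⊗≫
         X ◁ D ◁ ε_ A Aᘁ ⊗≫ 𝟙 _ := by
      rw [coendLift]; simp only [tensorRightHomEquiv, Equiv.coe_fn_symm_mk]; monoidal
    _ = 𝟙 _ ⊗≫ X ◁ η_ A Aᘁ ▷ A ⊗≫ (a X ▷ (Aᘁ ⊗ A) ≫ (X ⊗ D) ◁ ε_ A Aᘁ) ⊗≫ 𝟙 _ := by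
      rw [coaction_coendDesc, transposeFamily]; monoidal
    _ = 𝟙 _ ⊗≫ X ◁ (η_ A Aᘁ ▷ A ⊗≫ A ◁ ε_ A Aᘁ) ⊗≫ a X := by
      rw [← whisker_exchange]; monoidal
    _ = _ := by
      rw [ExactPairing.evaluation_coevaluation'']; monoidal

theorem coendLift_hom_ext (hC : Limits.IsColimit C) {A D : V} {f g : C.pt ⊗ A ⟶ D}
    (h : ∀ X, coaction C X ▷ A ≫ (α_ X C.pt A).hom ≫ X ◁ f =
      coaction C X ▷ A ≫ (α_ X C.pt A).hom ≫ X ◁ g) : f = g := by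
  apply (tensorRightHomEquiv C.pt A Aᘁ D).injective
  apply coend_hom_ext hC
  have key : ∀ (k : C.pt ⊗ A ⟶ D) (X : V),
      coaction C X ≫ X ◁ tensorRightHomEquiv C.pt A Aᘁ D k =
        𝟙 _ ⊗≫ X ◁ η_ A Aᘁ ⊗≫ (coaction C X ▷ A ≫ (α_ X C.pt A).hom ≫ X ◁ k) ▷ Aᘁ ⊗≫ 𝟙 _ := by
    intro k X
    simp only [tensorRightHomEquiv, Equiv.coe_fn_mk]
    calc
      _ = 𝟙 _ ⊗≫ (coaction C X ▷ 𝟙_ V ≫ (X ⊗ C.pt) ◁ η_ A Aᘁ) ⊗≫ X ◁ k ▷ Aᘁ := by monoidal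
      _ = _ := by rw [← whisker_exchange]; monoidal
  intro X
  rw [key, key, h]

set_option linter.unusedSectionVars false in
theorem coendHalfFamily_natural {D : V} (a : ∀ X Y : V, X ⊗ Y ⟶ (X ⊗ Y) ⊗ D)
    (ha : ∀ {X X' Y Y' : V} (f : X ⟶ X') (g : Y ⟶ Y'),
      (f ⊗ₘ g) ≫ a X' Y' = a X Y ≫ (f ⊗ₘ g) ▷ D) (Y : V) {X X' : V} (f : X ⟶ X') :
    f ▷ Y ≫ a X' Y ≫ (α_ X' Y D).hom = (a X Y ≫ (α_ X Y D).hom) ≫ f ▷ (Y ⊗ D) := by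
  have h := ha f (𝟙 Y)
  rw [tensorHom_id] at h
  rw [reassoc_of% h]
  simp

/-- The morphism `C ⊗ Y ⟶ Y ⊗ D` induced by a family `X ⊗ Y ⟶ (X ⊗ Y) ⊗ D` natural in `X`
and `Y`. -/
def coendHalfLift {D : V} (a : ∀ X Y : V, X ⊗ Y ⟶ (X ⊗ Y) ⊗ D)
    (ha : ∀ {X X' Y Y' : V} (f : X ⟶ X') (g : Y ⟶ Y'),
      (f ⊗ₘ g) ≫ a X' Y' = a X Y ≫ (f ⊗ₘ g) ▷ D) (Y : V) : C.pt ⊗ Y ⟶ Y ⊗ D :=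
  coendLift hC (fun X => a X Y ≫ (α_ X Y D).hom) (coendHalfFamily_natural a ha Y)

theorem coaction_coendHalfLift {D : V} (a : ∀ X Y : V, X ⊗ Y ⟶ (X ⊗ Y) ⊗ D)
    (ha : ∀ {X X' Y Y' : V} (f : X ⟶ X') (g : Y ⟶ Y'),
      (f ⊗ₘ g) ≫ a X' Y' = a X Y ≫ (f ⊗ₘ g) ▷ D) (X Y : V) :
    coaction C X ▷ Y ≫ (α_ X C.pt Y).hom ≫ X ◁ coendHalfLift hC a ha Y =
      a X Y ≫ (α_ X Y D).hom :=
  coaction_coendLift hC (fun X => a X Y ≫ (α_ X Y D).hom) (coendHalfFamily_natural a ha Y) X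

theorem coendHalfLift_natural {D : V} (a : ∀ X Y : V, X ⊗ Y ⟶ (X ⊗ Y) ⊗ D)
    (ha : ∀ {X X' Y Y' : V} (f : X ⟶ X') (g : Y ⟶ Y'),
      (f ⊗ₘ g) ≫ a X' Y' = a X Y ≫ (f ⊗ₘ g) ▷ D) {Y Y' : V} (g : Y ⟶ Y') :
    C.pt ◁ g ≫ coendHalfLift hC a ha Y' = coendHalfLift hC a ha Y ≫ g ▷ D := by
  apply coendLift_hom_ext hC
  intro X
  have h := ha (𝟙 X) g
  rw [id_tensorHom] at h
  calc
    _ = X ◁ g ≫ coaction C X ▷ Y' ≫ (α_ X C.pt Y').hom ≫ X ◁ coendHalfLift hC a ha Y' := by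
      rw [whisker_exchange_assoc]; simp
    _ = (coaction C X ▷ Y ≫ (α_ X C.pt Y).hom ≫ X ◁ coendHalfLift hC a ha Y) ≫ X ◁ g ▷ D := by
      rw [coaction_coendHalfLift, coaction_coendHalfLift, reassoc_of% h,
        associator_naturality_middle, Category.assoc]
    _ = _ := by simp

variable [BraidedCategory V]

/-- The morphism `C ⊗ C ⟶ D` induced by a family `X ⊗ Y ⟶ (X ⊗ Y) ⊗ D` natural in `X` and `Y`;
it is characterised by `coaction_coendLift₂` below. -/
def coendLift₂ {D : V} (a : ∀ X Y : V, X ⊗ Y ⟶ (X ⊗ Y) ⊗ D)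
    (ha : ∀ {X X' Y Y' : V} (f : X ⟶ X') (g : Y ⟶ Y'),
      (f ⊗ₘ g) ≫ a X' Y' = a X Y ≫ (f ⊗ₘ g) ▷ D) : C.pt ⊗ C.pt ⟶ D :=
  (β_ C.pt C.pt).hom ≫ coendLift hC (fun Y => (β_ C.pt Y).inv ≫ coendHalfLift hC a ha Y) (by
    intro Y Y' g
    rw [BraidedCategory.braiding_inv_naturality_left_assoc, Category.assoc,
      coendHalfLift_natural])

theorem coaction_coendLift₂ {D : V} (a : ∀ X Y : V, X ⊗ Y ⟶ (X ⊗ Y) ⊗ D)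
    (ha : ∀ {X X' Y Y' : V} (f : X ⟶ X') (g : Y ⟶ Y'),
      (f ⊗ₘ g) ≫ a X' Y' = a X Y ≫ (f ⊗ₘ g) ▷ D) (X Y : V) :
    (coaction C X ⊗ₘ coaction C Y) ≫ tensorμ X C.pt Y C.pt ≫ (X ⊗ Y) ◁ coendLift₂ hC a ha =
      a X Y := by
  have h := coaction_coendLift hC (fun Y => (β_ C.pt Y).inv ≫ coendHalfLift hC a ha Y) (by
    intro Y Y' g
    rw [BraidedCategory.braiding_inv_naturality_left_assoc, Category.assoc,
      coendHalfLift_natural]) Y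
  rw [← cancel_mono (α_ X Y D).hom, ← coaction_coendHalfLift hC a ha]
  set K := coendLift hC (fun Y => (β_ C.pt Y).inv ≫ coendHalfLift hC a ha Y) (by
    intro Y Y' g
    rw [BraidedCategory.braiding_inv_naturality_left_assoc, Category.assoc,
      coendHalfLift_natural]) with hK
  have h' : coendHalfLift hC a ha Y = (β_ C.pt Y).hom ≫ coaction C Y ▷ C.pt ≫
      (α_ Y C.pt C.pt).hom ≫ Y ◁ K := by
    rw [h, Iso.hom_inv_id_assoc]
  rw [h', coendLift₂, ← hK, tensorμ, ← BraidedCategory.braiding_naturality_right_assoc,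
    BraidedCategory.braiding_tensor_right_hom, MonoidalCategory.tensorHom_def]
  monoidal

/-- The double braiding. -/
def doubleBraiding (X Y : V) : X ⊗ Y ⟶ X ⊗ Y := (β_ X Y).hom ≫ (β_ Y X).hom

/-- The coproduct of the coend: `δ_X` followed by `δ_X ⊗ C` is `δ_X` followed by
`X ⊗ coendComul`. -/
def coendComul : C.pt ⟶ C.pt ⊗ C.pt :=
  coendDesc hC (fun X => coaction C X ≫ coaction C X ▷ C.pt ≫ (α_ X C.pt C.pt).hom) (by
    intro X Y f
    rw [reassoc_of% (coaction_natural C f), ← comp_whiskerRight_assoc, coaction_natural]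
    simp)

variable (C) in
/-- The unit of the coend: the universal coaction on the unit object. -/
def coendUnit : 𝟙_ V ⟶ C.pt := coaction C (𝟙_ V) ≫ (λ_ C.pt).hom

/-- The product of the coend, for which `δ_{X ⊗ Y}` is `δ_X ⊗ δ_Y` followed by the braiding of the
first copy of `C` with `Y` and by the product. -/
def coendMul : C.pt ⊗ C.pt ⟶ C.pt :=
  coendLift₂ hC (fun X Y => coaction C (X ⊗ Y)) (fun f g => coaction_natural C (f ⊗ₘ g))

/-- The canonical pairing `ω` of the coend, for which `δ_X ⊗ δ_Y` followed by the braiding of the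
first copy of `C` with `Y` and by `ω` is the double braiding of `X` and `Y`. -/
def coendPairing : C.pt ⊗ C.pt ⟶ 𝟙_ V :=
  coendLift₂ hC (fun X Y => doubleBraiding X Y ≫ (ρ_ (X ⊗ Y)).inv) (by
    intro X X' Y Y' f g
    simp [doubleBraiding])

/-- The left action of the coend on an object `Y`, for which the double braiding of `X` and `Y` is
`δ_X ⊗ Y` followed by `X ⊗ coendAct Y`. -/
def coendAct (Y : V) : C.pt ⊗ Y ⟶ Y :=
  C.pt ◁ coaction C Y ≫ (α_ C.pt Y C.pt).inv ≫ (β_ C.pt Y).hom ▷ C.pt ≫ (α_ Y C.pt C.pt).hom ≫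
    Y ◁ coendPairing hC ≫ (ρ_ Y).hom

end Coend

section Main

variable {V : Type u} [Category.{v} V] [MonoidalCategory V] [BraidedCategory V] [RigidCategory V]
  {C : Limits.Cowedge (dualTensor V)} (hC : Limits.IsColimit C)

/-- The map `Σ` which sends `p : C ⟶ D` to the natural transformation `X ⟶ X ⊗ D` given by the
universal coaction followed by `X ⊗ p`. -/
def coendSigma (C : Limits.Cowedge (dualTensor V)) {D : V} (p : C.pt ⟶ D) :
    𝟭 V ⟶ tensorRight D where
  app X := coaction C X ≫ X ◁ p
  naturality X Y f := by
    have h := coaction_natural C f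
    change f ≫ coaction C Y ≫ Y ◁ p = (coaction C X ≫ X ◁ p) ≫ f ▷ D
    rw [reassoc_of% h, Category.assoc, whisker_exchange]

/-- For a natural transformation `a` with components `X ⟶ X ⊗ H`, the natural endomorphism of the
forgetful functor from right `H`-modules whose component at a module is `a` followed by the
action. -/
def sharp {H : V} [MonObj H] (a : 𝟭 V ⟶ tensorRight H) :
    RightMod.forget H ⟶ RightMod.forget H where
  app M := a.app M.X ≫ M.act
  naturality M N f := by
    have h1 : f.hom ≫ a.app N.X = a.app M.X ≫ f.hom ▷ H := a.naturality f.hom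
    have h2 := f.linear
    change f.hom ≫ a.app N.X ≫ N.act = (a.app M.X ≫ M.act) ≫ f.hom
    rw [reassoc_of% h1, Category.assoc, h2]

/-- The endomorphism of `C ⊗ C` which accounts for the double braiding in the definition of a
twisted grouplike element. In terms of elements, with all crossings positive, it first applies the
coproduct to both factors, giving `(c₁ ⊗ c₂) ⊗ (d₁ ⊗ d₂)`, and then braids so as to get
`(d₁ ⊗ c₁) ⊗ (d₂ ⊗ c₂)`, pairs `c₁` with `d₂` by `ω`, and braids `d₁ ⊗ c₂` to `c₂ ⊗ d₁`. It is
the morphism `T` with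
`(δ_X ⊗ δ_Y) ≫ (X ⊗ β_{C,Y} ⊗ C) ≫ (X ⊗ Y ⊗ T) ≫ (X ⊗ β_{Y,C} ⊗ C)` equal to
the double braiding of `X` and `Y` followed by `δ_X ⊗ δ_Y`. -/
def coendTwist : C.pt ⊗ C.pt ⟶ C.pt ⊗ C.pt :=
  (coendComul hC ⊗ₘ coendComul hC) ≫ tensorμ C.pt C.pt C.pt C.pt ≫
    ((β_ C.pt C.pt).hom ⊗ₘ (β_ C.pt C.pt).hom) ≫ (α_ C.pt C.pt (C.pt ⊗ C.pt)).hom ≫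
      C.pt ◁ (α_ C.pt C.pt C.pt).inv ≫ C.pt ◁ coendPairing hC ▷ C.pt ≫
        C.pt ◁ (λ_ C.pt).hom ≫ (β_ C.pt C.pt).hom

/-- Twisted grouplike morphisms `C ⟶ H`. Through `Σ`, the first axiom says that `g_{X ⊗ Y}` followed
by the coproduct of `H`, and by the braiding of `Y` with the first copy of `H`, is the double
braiding of `X` and `Y` followed by `g_X ⊗ g_Y`. -/
structure IsTwistedGrouplike {H : V} [BimonObj H] (g : C.pt ⟶ H) : Prop where
  comul : coendMul hC ≫ g ≫ Δ[H] = coendTwist hC ≫ (g ⊗ₘ g)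
  counit : coendUnit C ≫ g ≫ ε[H] = 𝟙 (𝟙_ V)

/-- `C`-pivotal elements. The left hand side of the square-of-antipode axiom is the morphism
`C ⊗ H ⟶ H` obtained by coacting on `H` and multiplying by `p` on the right; on the right hand side,
`c ⊗ h` goes to the product of `p c₁` and the image of `c₂ ⊗ S² h` under the action of `C` on
`H` which encodes the double braiding. -/
structure IsCPivotal {H : V} [HopfObj H] (p : C.pt ⟶ H) : Prop extends
    IsTwistedGrouplike hC p where
  antipode_sq :
    C.pt ◁ coaction C H ≫ (α_ C.pt H C.pt).inv ≫ (β_ C.pt H).hom ▷ C.pt ≫ (α_ H C.pt C.pt).hom ≫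
      H ◁ (coendMul hC ≫ p) ≫ μ[H] =
    (coendComul hC ⊗ₘ (𝒮[H] ≫ 𝒮[H])) ≫ (α_ C.pt C.pt H).hom ≫ C.pt ◁ coendAct hC H ≫
      p ▷ H ≫ μ[H]

end Main

/-! ### Double braiding and the Drinfeld isomorphism for arbitrary chosen duals. -/

section Braiding

variable {V : Type u} [Category.{v} V] [MonoidalCategory V] [BraidedCategory V]

/-! The double dual of a module has the double dual in `V` as underlying object, and in `V` the
Drinfeld isomorphism μ is natural and invertible. So a family `M ⟶ ᘁᘁM` in `V`, natural in the
module `M`, is μ after a unique natural endomorphism of the forgetful functor. Free modules identify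
these endomorphisms with natural families `X ⟶ X ⊗ H` (`sharp_flat`, `flat_sharp`), and the coend
identifies the latter with morphisms `p : C ⟶ H` (`coendSigma_bijective`). It remains to translate
the conditions on a pivotal structure one at a time into conditions on `p`.

Linearity: μ carries the double dual action to the original one preceded by the double braiding of
`M` with `H` and by S² (`drinfeldIso_dualAct`). Cancelling μ leaves an equation on `M ⊗ H` whose
sides come from the two sides of the square-of-antipode axiom (`act_coendEndo`,
`doubleBraiding_antipode_coendEndo`).

Tensor products: μ is monoidal only up to the double braiding (`doubleBraiding_drinfeld_tensor`),
and `T` is the operator on `C ⊗ C` that produces this double braiding (`coaction_coendTwist`).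
Compatibility thus becomes the twisted grouplike equation. On the unit μ is trivial, which gives the
counit axiom.

These are equivalences because free modules detect equality of morphisms out of `C ⊗ H` and `C ⊗ C`
(`free_hom_ext`, `free_hom_ext₂`). -/

theorem doubleBraiding_natural {X X' Y Y' : V} (f : X ⟶ X') (g : Y ⟶ Y') :
    (f ⊗ₘ g) ≫ doubleBraiding X' Y' = doubleBraiding X Y ≫ (f ⊗ₘ g) := by
  simp [doubleBraiding]

instance isIso_doubleBraiding (X Y : V) : IsIso (doubleBraiding X Y) := by
  rw [doubleBraiding]
  infer_instance

theorem doubleBraiding_tensor_left (X Y Z : V) : doubleBraiding (X ⊗ Y) Z =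
    𝟙 _ ⊗≫ X ◁ (β_ Y Z).hom ⊗≫ doubleBraiding X Z ▷ Y ⊗≫ X ◁ (β_ Z Y).hom ⊗≫ 𝟙 _ := by
  rw [doubleBraiding, doubleBraiding, BraidedCategory.braiding_tensor_left_hom,
    BraidedCategory.braiding_tensor_right_hom]
  monoidal

/-- Naturality of the braiding in its first argument, applied to a map into the unit: a pairing can
be pulled across the strand `Z`. -/
theorem braiding_slide {A B : V} (e : A ⊗ B ⟶ 𝟙_ V) (Z : V) :
    A ◁ (β_ B Z).hom ⊗≫ (β_ A Z).hom ▷ B ⊗≫ Z ◁ e ⊗≫ 𝟙 Z = 𝟙 _ ⊗≫ e ▷ Z ⊗≫ 𝟙 Z := by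
  have h := BraidedCategory.braiding_naturality_left e Z
  rw [BraidedCategory.braiding_tensor_left_hom, braiding_tensorUnit_left] at h
  calc
    _ = 𝟙 _ ⊗≫ (((α_ A B Z).hom ≫ A ◁ (β_ B Z).hom ≫
          (α_ A Z B).inv ≫ (β_ A Z).hom ▷ B ≫ (α_ Z A B).hom) ≫ Z ◁ e) ⊗≫ 𝟙 _ := by
      monoidal
    _ = _ := by
      rw [← h]; monoidal

/-- If `Y` is a dual of `X` and `Z` is a dual of `Y`, the Drinfeld isomorphism from `X` to `Z`. -/
def drinfeldIso (X Y Z : V) [ExactPairing Y X] [ExactPairing Z Y] : X ≅ Z :=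
  leftDualIso (BraidedCategory.exactPairing_swap Y X) inferInstance

/-- The comparison of two duals is the mate of an identity, so this is the defining equation of a
mate. -/
theorem leftDualIso_hom_evaluation {C : Type u} [Category.{v} C] [MonoidalCategory C]
    {X₁ X₂ Y : C} (p₁ : ExactPairing X₁ Y) (p₂ : ExactPairing X₂ Y) :
    Y ◁ (leftDualIso p₁ p₂).hom ≫ p₂.evaluation' = p₁.evaluation' := by
  have h := @leftAdjointMate_comp_evaluation C _ _ Y Y ⟨X₂⟩ ⟨X₁⟩ (𝟙 Y)
  rw [id_whiskerRight, Category.id_comp] at h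
  exact h

/-- Since a morphism into a dual is determined by its evaluation, this equation characterises the
Drinfeld isomorphism; the properties below are checked through it. -/
theorem drinfeldIso_hom_evaluation (X Y Z : V) [ExactPairing Y X] [ExactPairing Z Y] :
    Y ◁ (drinfeldIso X Y Z).hom ≫ ε_ Z Y = (β_ Y X).hom ≫ ε_ Y X :=
  leftDualIso_hom_evaluation _ _

theorem eq_drinfeldIso_hom {X Y Z : V} [ExactPairing Y X] [ExactPairing Z Y] {f : X ⟶ Z}
    (h : Y ◁ f ≫ ε_ Z Y = (β_ Y X).hom ≫ ε_ Y X) : f = (drinfeldIso X Y Z).hom :=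
  RightMod.dual_hom_ext (X := Y) (h.trans (drinfeldIso_hom_evaluation X Y Z).symm)

theorem drinfeldIso_unit : (drinfeldIso (𝟙_ V) (𝟙_ V) (𝟙_ V)).hom = 𝟙 (𝟙_ V) := by
  symm
  apply eq_drinfeldIso_hom
  rw [braiding_tensorUnit_left]
  simp [unitors_equal]

/-- After evaluation against `Y₂ ⊗ Y₁`, both sides are the two twisted pairings `β ≫ ε`. The left
side has them interleaved and the right side nested; sliding each pairing across the other strand
accounts for exactly one double braiding. -/
theorem doubleBraiding_drinfeldIso_tensor (X₁ X₂ Y₁ Y₂ Z₁ Z₂ : V) [ExactPairing Y₁ X₁]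
    [ExactPairing Y₂ X₂] [ExactPairing Z₁ Y₁] [ExactPairing Z₂ Y₂] :
    doubleBraiding X₁ X₂ ≫ (drinfeldIso (X₁ ⊗ X₂) (Y₂ ⊗ Y₁) (Z₁ ⊗ Z₂)).hom =
      ((drinfeldIso X₁ Y₁ Z₁).hom ⊗ₘ (drinfeldIso X₂ Y₂ Z₂).hom) := by
  apply RightMod.dual_hom_ext (X := Y₂ ⊗ Y₁)
  rw [MonoidalCategory.whiskerLeft_comp, Category.assoc, drinfeldIso_hom_evaluation,
    ExactPairing.tensor_evaluation, ExactPairing.tensor_evaluation, doubleBraiding]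
  symm
  calc
    _ = 𝟙 _ ⊗≫ Y₂ ◁ (Y₁ ◁ (drinfeldIso X₁ Y₁ Z₁).hom ≫ ε_ Z₁ Y₁) ▷ X₂ ⊗≫
        Y₂ ◁ (drinfeldIso X₂ Y₂ Z₂).hom ≫ ε_ Z₂ Y₂ := by
      rw [MonoidalCategory.tensorHom_def]
      calc
        _ = 𝟙 _ ⊗≫ Y₂ ◁ Y₁ ◁ (drinfeldIso X₁ Y₁ Z₁).hom ▷ X₂ ⊗≫ Y₂ ◁ ((Y₁ ⊗ Z₁) ◁
            (drinfeldIso X₂ Y₂ Z₂).hom ≫ ε_ Z₁ Y₁ ▷ Z₂) ⊗≫ ε_ Z₂ Y₂ := by monoidal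
        _ = _ := by rw [whisker_exchange]; monoidal
    _ = 𝟙 _ ⊗≫ Y₂ ◁ (𝟙 (Y₁ ⊗ X₁ ⊗ X₂) ⊗≫ ((β_ Y₁ X₁).hom ≫ ε_ Y₁ X₁) ▷ X₂ ⊗≫ 𝟙 X₂) ⊗≫
        (β_ Y₂ X₂).hom ≫ ε_ Y₂ X₂ := by
      rw [drinfeldIso_hom_evaluation, drinfeldIso_hom_evaluation]; monoidal
    -- The inner pairing of `Y₁` and `X₁` is pulled to the right of `X₂`.
    _ = 𝟙 _ ⊗≫ Y₂ ◁ Y₁ ◁ (β_ X₁ X₂).hom ⊗≫ Y₂ ◁ (β_ Y₁ X₂).hom ▷ X₁ ⊗≫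
        Y₂ ◁ X₂ ◁ (β_ Y₁ X₁).hom ⊗≫ ((Y₂ ⊗ X₂) ◁ ε_ Y₁ X₁ ≫ ((β_ Y₂ X₂).hom ≫ ε_ Y₂ X₂) ▷ 𝟙_ V) ⊗≫
          𝟙 _ := by
      rw [← braiding_slide ((β_ Y₁ X₁).hom ≫ ε_ Y₁ X₁) X₂]; monoidal
    _ = 𝟙 _ ⊗≫ Y₂ ◁ Y₁ ◁ (β_ X₁ X₂).hom ⊗≫ Y₂ ◁ (β_ Y₁ X₂).hom ▷ X₁ ⊗≫
        Y₂ ◁ X₂ ◁ (β_ Y₁ X₁).hom ⊗≫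
        (𝟙 (Y₂ ⊗ X₂ ⊗ X₁) ⊗≫ ((β_ Y₂ X₂).hom ≫ ε_ Y₂ X₂) ▷ X₁ ⊗≫ 𝟙 X₁) ▷ Y₁ ⊗≫ ε_ Y₁ X₁ := by
      rw [whisker_exchange]; monoidal
    -- The pairing of `Y₂` and `X₂` is pulled across `X₁` in the same way.
    _ = 𝟙 _ ⊗≫ Y₂ ◁ Y₁ ◁ (β_ X₁ X₂).hom ⊗≫ Y₂ ◁ ((β_ Y₁ (X₂ ⊗ X₁)).hom ≫
          (β_ X₂ X₁).hom ▷ Y₁) ⊗≫ (β_ Y₂ X₁).hom ▷ X₂ ▷ Y₁ ⊗≫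
        X₁ ◁ ((β_ Y₂ X₂).hom ≫ ε_ Y₂ X₂) ▷ Y₁ ⊗≫ ε_ Y₁ X₁ := by
      rw [← braiding_slide ((β_ Y₂ X₂).hom ≫ ε_ Y₂ X₂) X₁, BraidedCategory.braiding_tensor_right_hom]; monoidal
    -- Naturality moves `β_ X₂ X₁` in front of the crossing with `Y₁`, next to `β_ X₁ X₂`, and
    -- completes the double braiding.
    _ = _ := by
      rw [← BraidedCategory.braiding_naturality_right, BraidedCategory.braiding_tensor_left_hom,
        BraidedCategory.braiding_tensor_right_hom, BraidedCategory.braiding_tensor_right_hom]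
      monoidal

/-- Each passage to a dual contributes one antipode and one crossing of `H` with the dual.
Transported to `X`, the two passages add up to S² and, by naturality, to a full double braiding of
`X` with `H`. -/
theorem drinfeldIso_dualAct {H : V} [HopfObj H] (X Y Z : V) [ExactPairing Y X]
    [ExactPairing Z Y] (r : X ⊗ H ⟶ X) :
    (drinfeldIso X Y Z).hom ▷ H ≫ RightMod.dualAct Z (RightMod.dualAct Y r) =
      (doubleBraiding X H ≫ X ◁ (𝒮[H] ≫ 𝒮[H]) ≫ r) ≫ (drinfeldIso X Y Z).hom := by
  apply RightMod.dual_hom_ext (X := Y)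
  rw [MonoidalCategory.whiskerLeft_comp, Category.assoc, RightMod.dualAct_evaluation,
    MonoidalCategory.whiskerLeft_comp, Category.assoc, drinfeldIso_hom_evaluation]
  calc
    _ = Y ◁ ((drinfeldIso X Y Z).hom ▷ H ≫ (β_ Z H).hom) ⊗≫
        RightMod.antipodeAct (RightMod.dualAct Y r) ▷ Z ≫ ε_ Z Y := by
      rw [RightMod.dualPairing]; monoidal
    _ = Y ◁ (β_ X H).hom ⊗≫ ((Y ⊗ H) ◁ (drinfeldIso X Y Z).hom ≫
        RightMod.antipodeAct (RightMod.dualAct Y r) ▷ Z) ≫ ε_ Z Y := by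
      rw [BraidedCategory.braiding_naturality_left]; monoidal
    _ = Y ◁ (β_ X H).hom ⊗≫ RightMod.antipodeAct (RightMod.dualAct Y r) ▷ X ≫
        (Y ◁ (drinfeldIso X Y Z).hom ≫ ε_ Z Y) := by
      rw [whisker_exchange]; monoidal
    _ = Y ◁ (β_ X H).hom ⊗≫ Y ◁ 𝒮[H] ▷ X ⊗≫ (RightMod.dualAct Y r ▷ X ≫ (β_ Y X).hom) ≫
        ε_ Y X := by
      rw [drinfeldIso_hom_evaluation, RightMod.antipodeAct]; monoidal
    _ = Y ◁ (β_ X H).hom ⊗≫ Y ◁ 𝒮[H] ▷ X ⊗≫ (β_ (Y ⊗ H) X).hom ≫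
        (X ◁ RightMod.dualAct Y r ≫ ε_ Y X) := by
      rw [BraidedCategory.braiding_naturality_left]; monoidal
    -- Evaluating the inner dual action brings in the second antipode.
    _ = Y ◁ (β_ X H).hom ⊗≫ Y ◁ (𝒮[H] ▷ X ≫ (β_ H X).hom) ⊗≫ ((β_ Y (X ⊗ H)).hom ≫
        RightMod.antipodeAct r ▷ Y) ≫ ε_ Y X := by
      rw [RightMod.dualAct_evaluation, RightMod.dualPairing,
        BraidedCategory.braiding_tensor_left_hom, BraidedCategory.braiding_tensor_right_hom]
      monoidal
    _ = _ := by
      rw [← BraidedCategory.braiding_naturality_right, BraidedCategory.braiding_naturality_left,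
        doubleBraiding, RightMod.antipodeAct]
      monoidal

end Braiding

/-! ### The Drinfeld morphism for the chosen duals: invertibility, naturality, tensor products. -/

section Pivotal

variable {C : Type u} [Category.{v} C] [MonoidalCategory C]

theorem doubleDualIso_hom_evaluation [LeftRigidCategory C] (X Y Z : C) [ExactPairing Y X]
    [ExactPairing Z Y] :
    Y ◁ ((doubleDualIso X Y Z).hom : (ᘁ(ᘁX) : C) ⟶ Z) ≫ ε_ Z Y =
      (leftDualIso (HasLeftDual.exact : ExactPairing (ᘁX : C) X)
        (inferInstance : ExactPairing Y X)).inv ▷ (ᘁ(ᘁX) : C) ≫ ε_ (ᘁ(ᘁX) : C) (ᘁX : C) :=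
  leftDualIso_hom_evaluation _ _

variable [BraidedCategory C] [LeftRigidCategory C]

theorem drinfeld_eq_drinfeldIso_hom (X : C) :
    drinfeld X = (drinfeldIso X (ᘁX : C) (ᘁ(ᘁX) : C)).hom := by
  -- The mate of the identity written out: it differs from `drinfeld` only by a whiskered identity
  -- of `ᘁX` and by bracketing.
  change _ = (λ_ _).inv ≫ η_ (ᘁ(ᘁX) : C) (ᘁX : C) ▷ X ≫ ((ᘁ(ᘁX) : C) ◁ 𝟙 (ᘁX : C)) ▷ X ≫
    (α_ _ _ _).hom ≫ (ᘁ(ᘁX) : C) ◁ ((β_ (ᘁX : C) X).hom ≫ ε_ (ᘁX : C) X) ≫ (ρ_ _).hom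
  simp only [MonoidalCategory.whiskerLeft_id, id_whiskerRight, Category.id_comp,
    MonoidalCategory.whiskerLeft_comp, Category.assoc]
  rfl

instance isIso_drinfeld (X : C) : IsIso (drinfeld X) := by
  rw [drinfeld_eq_drinfeldIso_hom]
  exact (drinfeldIso X (ᘁX : C) (ᘁ(ᘁX) : C)).isIso_hom

/-- This makes the choice of duals irrelevant. It is needed because the chosen dual of `X ⊗ Y` need
not be `ᘁY ⊗ ᘁX`, nor that of the unit the unit. -/
theorem drinfeld_comp_doubleDualIso_hom (X Y Z : C) [ExactPairing Y X] [ExactPairing Z Y] :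
    drinfeld X ≫ (doubleDualIso X Y Z).hom = (drinfeldIso X Y Z).hom := by
  have key : ∀ e : (ᘁ(ᘁX) : C) ⟶ Z, Y ◁ e ≫ ε_ Z Y =
      (leftDualIso (HasLeftDual.exact : ExactPairing (ᘁX : C) X)
        (inferInstance : ExactPairing Y X)).inv ▷ (ᘁ(ᘁX) : C) ≫ ε_ (ᘁ(ᘁX) : C) (ᘁX : C) →
      (drinfeldIso X (ᘁX : C) (ᘁ(ᘁX) : C)).hom ≫ e = (drinfeldIso X Y Z).hom := by
    intro e he
    apply eq_drinfeldIso_hom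
    rw [MonoidalCategory.whiskerLeft_comp, Category.assoc, he, whisker_exchange_assoc,
      drinfeldIso_hom_evaluation, BraidedCategory.braiding_naturality_left_assoc]
    congr 1
    rw [← cancel_epi (X ◁ (leftDualIso HasLeftDual.exact (inferInstance : ExactPairing Y X)).hom),
      whiskerLeft_hom_inv_assoc]
    exact (leftDualIso_hom_evaluation _ _).symm
  rw [drinfeld_eq_drinfeldIso_hom]
  exact key _ (doubleDualIso_hom_evaluation X Y Z)

theorem drinfeldIso_hom_natural {X Y : C} (f : X ⟶ Y) :
    f ≫ (drinfeldIso Y (ᘁY : C) (ᘁ(ᘁY) : C)).hom =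
      (drinfeldIso X (ᘁX : C) (ᘁ(ᘁX) : C)).hom ≫ (ᘁ(ᘁf)) := by
  apply RightMod.dual_hom_ext (X := (ᘁY : C))
  rw [MonoidalCategory.whiskerLeft_comp, MonoidalCategory.whiskerLeft_comp, Category.assoc,
    Category.assoc, drinfeldIso_hom_evaluation, leftAdjointMate_comp_evaluation,
    whisker_exchange_assoc, drinfeldIso_hom_evaluation,
    BraidedCategory.braiding_naturality_right_assoc,
    BraidedCategory.braiding_naturality_left_assoc, leftAdjointMate_comp_evaluation]

theorem drinfeld_natural {X Y : C} (f : X ⟶ Y) :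
    f ≫ drinfeld Y = drinfeld X ≫ (doubleDual C).map f := by
  rw [drinfeld_eq_drinfeldIso_hom, drinfeld_eq_drinfeldIso_hom]
  exact drinfeldIso_hom_natural f

theorem drinfeld_unit : drinfeld (𝟙_ C) ≫ (doubleDualUnitIso C).hom = 𝟙 (𝟙_ C) := by
  rw [doubleDualUnitIso, drinfeld_comp_doubleDualIso_hom, drinfeldIso_unit]

theorem doubleBraiding_drinfeld_tensor (X Y : C) :
    doubleBraiding X Y ≫ drinfeld (X ⊗ Y) ≫ (doubleDualTensorIso X Y).hom =
      (drinfeld X ⊗ₘ drinfeld Y) := by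
  rw [drinfeld_eq_drinfeldIso_hom X, drinfeld_eq_drinfeldIso_hom Y]
  refine Eq.trans ?_ (doubleBraiding_drinfeldIso_tensor X Y (ᘁX : C) (ᘁY : C) (ᘁ(ᘁX) : C)
    (ᘁ(ᘁY) : C))
  rw [← drinfeld_comp_doubleDualIso_hom]
  rfl

end Pivotal

/-! ### Structure morphisms of the coend and the operator `T`. -/

section CoendStructure

variable {V : Type u} [Category.{v} V] [MonoidalCategory V]

variable [RigidCategory V] {C : Limits.Cowedge (dualTensor V)} (hC : Limits.IsColimit C)

theorem coaction_coendComul (X : V) : coaction C X ≫ X ◁ coendComul hC =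
    coaction C X ≫ coaction C X ▷ C.pt ≫ (α_ X C.pt C.pt).hom :=
  coaction_coendDesc hC (fun X => coaction C X ≫ coaction C X ▷ C.pt ≫ (α_ X C.pt C.pt).hom) (by
    intro X Y f
    rw [reassoc_of% (coaction_natural C f), ← comp_whiskerRight_assoc, coaction_natural]
    simp) X

variable [BraidedCategory V]

theorem coaction_coendMul (X Y : V) : (coaction C X ⊗ₘ coaction C Y) ≫ tensorμ X C.pt Y C.pt ≫
    (X ⊗ Y) ◁ coendMul hC = coaction C (X ⊗ Y) :=
  coaction_coendLift₂ hC (fun X Y => coaction C (X ⊗ Y))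
    (fun f g => coaction_natural C (f ⊗ₘ g)) X Y

theorem coaction_coendPairing (X Y : V) : (coaction C X ⊗ₘ coaction C Y) ≫
    tensorμ X C.pt Y C.pt ≫ (X ⊗ Y) ◁ coendPairing hC = doubleBraiding X Y ≫ (ρ_ (X ⊗ Y)).inv :=
  coaction_coendLift₂ hC (fun X Y => doubleBraiding X Y ≫ (ρ_ (X ⊗ Y)).inv) (by
    intro X X' Y Y' f g
    simp [doubleBraiding]) X Y

/-- One-variable uniqueness applied twice, first for the copy of `C` belonging to `Y` and then for
the one belonging to `X`. -/
theorem coendLift₂_hom_ext (hC : Limits.IsColimit C) {D : V} {f g : C.pt ⊗ C.pt ⟶ D}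
    (h : ∀ X Y, (coaction C X ⊗ₘ coaction C Y) ≫ tensorμ X C.pt Y C.pt ≫ (X ⊗ Y) ◁ f =
      (coaction C X ⊗ₘ coaction C Y) ≫ tensorμ X C.pt Y C.pt ≫ (X ⊗ Y) ◁ g) : f = g := by
  -- One-variable uniqueness concerns the leftmost copy of `C`, so the copy belonging to `Y` is
  -- first braided to the left.
  rw [← cancel_epi (β_ C.pt C.pt).inv]
  apply coendLift_hom_ext hC
  intro Y
  rw [← cancel_epi (β_ C.pt Y).hom]
  apply coendLift_hom_ext hC
  intro X
  have key : ∀ k : C.pt ⊗ C.pt ⟶ D, coaction C X ▷ Y ≫ (α_ X C.pt Y).hom ≫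
      X ◁ ((β_ C.pt Y).hom ≫ coaction C Y ▷ C.pt ≫ (α_ Y C.pt C.pt).hom ≫
        Y ◁ ((β_ C.pt C.pt).inv ≫ k)) =
      ((coaction C X ⊗ₘ coaction C Y) ≫ tensorμ X C.pt Y C.pt ≫ (X ⊗ Y) ◁ k) ≫
        (α_ X Y D).hom := by
    intro k
    rw [← BraidedCategory.braiding_naturality_right_assoc,
      BraidedCategory.braiding_tensor_right_hom, MonoidalCategory.tensorHom_def, tensorμ]
    calc
      _ = coaction C X ▷ Y ⊗≫ X ◁ C.pt ◁ coaction C Y ⊗≫ X ◁ (β_ C.pt Y).hom ▷ C.pt ⊗≫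
          X ◁ Y ◁ ((β_ C.pt C.pt).hom ≫ (β_ C.pt C.pt).inv) ⊗≫ X ◁ Y ◁ k := by monoidal
      _ = _ := by rw [Iso.hom_inv_id]; monoidal
  rw [key, key, h]

theorem coaction_coendAct (X Y : V) :
    coaction C X ▷ Y ≫ (α_ X C.pt Y).hom ≫ X ◁ coendAct hC Y = doubleBraiding X Y := by
  rw [← cancel_mono (ρ_ (X ⊗ Y)).inv, ← coaction_coendPairing hC, coendAct, tensorμ,
    MonoidalCategory.tensorHom_def]
  monoidal

/-- Unfolding `T`, the outer crossings merge with its inner ones by naturality and the hexagons, so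
that `Y ⊗ C` is crossed as a block. This is the shape that arises in `coaction_coendTwist`, where
`C` braids past a coacted `Y`. -/
theorem coendTwist_crossing (Y : V) :
    𝟙 (C.pt ⊗ (Y ⊗ C.pt)) ⊗≫ (β_ C.pt Y).hom ▷ C.pt ⊗≫ Y ◁ coendTwist hC ⊗≫
        (β_ Y C.pt).hom ▷ C.pt ⊗≫ 𝟙 ((C.pt ⊗ Y) ⊗ C.pt) =
      𝟙 _ ⊗≫ coendComul hC ▷ (Y ⊗ C.pt) ⊗≫ C.pt ◁ ((β_ C.pt (Y ⊗ C.pt)).hom ≫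
        (Y ◁ coendComul hC) ▷ C.pt) ⊗≫ (β_ C.pt (Y ⊗ C.pt)).hom ▷ (C.pt ⊗ C.pt) ⊗≫
          (Y ⊗ C.pt) ◁ coendPairing hC ▷ C.pt ⊗≫ (β_ (Y ⊗ C.pt) C.pt).hom ⊗≫ 𝟙 _ := by
  symm
  calc
    _ = 𝟙 _ ⊗≫ coendComul hC ▷ (Y ⊗ C.pt) ⊗≫ (C.pt ⊗ C.pt) ◁ Y ◁ coendComul hC ⊗≫
          C.pt ◁ (β_ C.pt Y).hom ▷ (C.pt ⊗ C.pt) ⊗≫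
          ((C.pt ⊗ Y) ◁ ((β_ C.pt C.pt).hom ▷ C.pt ⊗≫ C.pt ◁ (β_ C.pt C.pt).hom) ≫
            (β_ C.pt Y).hom ▷ (C.pt ⊗ C.pt ⊗ C.pt)) ⊗≫
          Y ◁ (β_ C.pt C.pt).hom ▷ (C.pt ⊗ C.pt) ⊗≫
          (Y ⊗ C.pt) ◁ coendPairing hC ▷ C.pt ⊗≫ Y ◁ (β_ C.pt C.pt).hom ⊗≫
          (β_ Y C.pt).hom ▷ C.pt ⊗≫ 𝟙 _ := by
      rw [← BraidedCategory.braiding_naturality_right,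
        BraidedCategory.braiding_tensor_right_hom, BraidedCategory.braiding_tensor_right_hom,
        BraidedCategory.braiding_tensor_right_hom, BraidedCategory.braiding_tensor_left_hom]
      monoidal
    _ = 𝟙 _ ⊗≫ (coendComul hC ▷ (Y ⊗ C.pt) ≫ (C.pt ⊗ C.pt) ◁ Y ◁ coendComul hC) ⊗≫
          (β_ (C.pt ⊗ C.pt) Y).hom ▷ (C.pt ⊗ C.pt) ⊗≫
          (Y ⊗ C.pt) ◁ (β_ C.pt C.pt).hom ▷ C.pt ⊗≫
          Y ◁ ((C.pt ⊗ C.pt) ◁ (β_ C.pt C.pt).hom ≫ (β_ C.pt C.pt).hom ▷ (C.pt ⊗ C.pt)) ⊗≫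
          (Y ⊗ C.pt) ◁ coendPairing hC ▷ C.pt ⊗≫ Y ◁ (β_ C.pt C.pt).hom ⊗≫
          (β_ Y C.pt).hom ▷ C.pt ⊗≫ 𝟙 _ := by
      rw [whisker_exchange, BraidedCategory.braiding_tensor_left_hom]
      monoidal
    _ = 𝟙 _ ⊗≫ C.pt ◁ Y ◁ coendComul hC ⊗≫ (coendComul hC ▷ Y ≫
          (β_ (C.pt ⊗ C.pt) Y).hom) ▷ (C.pt ⊗ C.pt) ⊗≫
          (Y ⊗ C.pt) ◁ (β_ C.pt C.pt).hom ▷ C.pt ⊗≫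
          Y ◁ ((β_ C.pt C.pt).hom ⊗ₘ (β_ C.pt C.pt).hom) ⊗≫
          (Y ⊗ C.pt) ◁ coendPairing hC ▷ C.pt ⊗≫ Y ◁ (β_ C.pt C.pt).hom ⊗≫
          (β_ Y C.pt).hom ▷ C.pt ⊗≫ 𝟙 _ := by
      rw [← whisker_exchange, MonoidalCategory.tensorHom_def']
      monoidal
    _ = 𝟙 _ ⊗≫ ((C.pt ⊗ Y) ◁ coendComul hC ≫ (β_ C.pt Y).hom ▷ (C.pt ⊗ C.pt)) ⊗≫
          Y ◁ coendComul hC ▷ (C.pt ⊗ C.pt) ⊗≫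
          (Y ⊗ C.pt) ◁ (β_ C.pt C.pt).hom ▷ C.pt ⊗≫
          Y ◁ ((β_ C.pt C.pt).hom ⊗ₘ (β_ C.pt C.pt).hom) ⊗≫
          (Y ⊗ C.pt) ◁ coendPairing hC ▷ C.pt ⊗≫ Y ◁ (β_ C.pt C.pt).hom ⊗≫
          (β_ Y C.pt).hom ▷ C.pt ⊗≫ 𝟙 _ := by
      rw [BraidedCategory.braiding_naturality_left]
      monoidal
    _ = _ := by
      rw [whisker_exchange, coendTwist, tensorμ, MonoidalCategory.tensorHom_def' (coendComul hC)]
      monoidal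

/-- The double braiding is expressed through ω; the coaction that follows is then moved before the
crossing, and coassociativity merges the two coactions on `Y` into a coproduct. -/
theorem doubleBraiding_whiskerLeft_coaction (X Y : V) :
    doubleBraiding X Y ≫ X ◁ coaction C Y =
      coaction C X ▷ Y ⊗≫ X ◁ C.pt ◁ coaction C Y ⊗≫ (X ⊗ C.pt) ◁ Y ◁ coendComul hC ⊗≫
        X ◁ (β_ C.pt (Y ⊗ C.pt)).hom ▷ C.pt ⊗≫ (X ⊗ Y ⊗ C.pt) ◁ coendPairing hC ⊗≫
          𝟙 (X ⊗ Y ⊗ C.pt) := by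
  have h : doubleBraiding X Y = (coaction C X ⊗ₘ coaction C Y) ≫
      tensorμ X C.pt Y C.pt ≫ (X ⊗ Y) ◁ coendPairing hC ≫ (ρ_ (X ⊗ Y)).hom := by
    rw [reassoc_of% (coaction_coendPairing hC X Y), Iso.inv_hom_id, Category.comp_id]
  rw [h, tensorμ, MonoidalCategory.tensorHom_def]
  calc
    _ = coaction C X ▷ Y ⊗≫ X ◁ C.pt ◁ coaction C Y ⊗≫ X ◁ (β_ C.pt Y).hom ▷ C.pt ⊗≫
        X ◁ (Y ◁ coendPairing hC ≫ coaction C Y ▷ 𝟙_ V) ⊗≫ 𝟙 _ := by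
      monoidal
    _ = coaction C X ▷ Y ⊗≫ X ◁ C.pt ◁ coaction C Y ⊗≫ X ◁ ((β_ C.pt Y).hom ≫
        coaction C Y ▷ C.pt) ▷ C.pt ⊗≫ (X ⊗ Y ⊗ C.pt) ◁ coendPairing hC ⊗≫ 𝟙 _ := by
      rw [whisker_exchange]; monoidal
    _ = coaction C X ▷ Y ⊗≫ X ◁ C.pt ◁ (coaction C Y ≫ coaction C Y ▷ C.pt ≫
        (α_ Y C.pt C.pt).hom) ⊗≫ X ◁ (β_ C.pt (Y ⊗ C.pt)).hom ▷ C.pt ⊗≫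
          (X ⊗ Y ⊗ C.pt) ◁ coendPairing hC ⊗≫ 𝟙 _ := by
      rw [← BraidedCategory.braiding_naturality_right]; monoidal
    _ = _ := by
      rw [← coaction_coendComul hC]; monoidal

/-- By naturality, the coaction on `X` can be made first, and the double braiding of `X ⊗ C` with
`Y` is that of `X` with `Y` between two crossings of `C` with `Y`. The inner one is rewritten
through ω, which creates a second coaction on each object; these merge into the two coproducts of
`T`. -/
theorem coaction_coendTwist (X Y : V) : (coaction C X ⊗ₘ coaction C Y) ≫ tensorμ X C.pt Y C.pt ≫
    (X ⊗ Y) ◁ coendTwist hC ≫ tensorμ X Y C.pt C.pt =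
      doubleBraiding X Y ≫ (coaction C X ⊗ₘ coaction C Y) := by
  symm
  have h : doubleBraiding X Y ≫ coaction C X ▷ Y =
      coaction C X ▷ Y ≫ doubleBraiding (X ⊗ C.pt) Y := by
    have h' := doubleBraiding_natural (coaction C X) (𝟙 Y)
    rwa [tensorHom_id, eq_comm] at h'
  rw [MonoidalCategory.tensorHom_def, reassoc_of% h, doubleBraiding_tensor_left]
  calc
    _ = coaction C X ▷ Y ⊗≫ X ◁ (β_ C.pt Y).hom ⊗≫ doubleBraiding X Y ▷ C.pt ⊗≫
        X ◁ ((β_ Y C.pt).hom ≫ C.pt ◁ coaction C Y) ⊗≫ 𝟙 _ := by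
      monoidal
    _ = coaction C X ▷ Y ⊗≫ X ◁ (β_ C.pt Y).hom ⊗≫ (doubleBraiding X Y ≫
        X ◁ coaction C Y) ▷ C.pt ⊗≫ X ◁ (β_ (Y ⊗ C.pt) C.pt).hom ⊗≫ 𝟙 _ := by
      rw [← BraidedCategory.braiding_naturality_left]; monoidal
    _ = coaction C X ▷ Y ⊗≫ (X ◁ (β_ C.pt Y).hom ≫ coaction C X ▷ (Y ⊗ C.pt)) ⊗≫
        (X ◁ C.pt ◁ coaction C Y ⊗≫ (X ⊗ C.pt) ◁ Y ◁ coendComul hC ⊗≫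
          X ◁ (β_ C.pt (Y ⊗ C.pt)).hom ▷ C.pt ⊗≫ (X ⊗ Y ⊗ C.pt) ◁ coendPairing hC ⊗≫
            𝟙 (X ⊗ Y ⊗ C.pt)) ▷ C.pt ⊗≫ X ◁ (β_ (Y ⊗ C.pt) C.pt).hom ⊗≫ 𝟙 _ := by
      rw [doubleBraiding_whiskerLeft_coaction hC]; monoidal
    _ = (coaction C X ≫ coaction C X ▷ C.pt ≫ (α_ X C.pt C.pt).hom) ▷ Y ⊗≫
        X ◁ C.pt ◁ ((β_ C.pt Y).hom ≫ coaction C Y ▷ C.pt) ⊗≫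
        (X ⊗ C.pt) ◁ (Y ◁ coendComul hC) ▷ C.pt ⊗≫
          X ◁ (β_ C.pt (Y ⊗ C.pt)).hom ▷ C.pt ▷ C.pt ⊗≫
          (X ⊗ Y ⊗ C.pt) ◁ coendPairing hC ▷ C.pt ⊗≫
            X ◁ (β_ (Y ⊗ C.pt) C.pt).hom ⊗≫ 𝟙 _ := by
      rw [whisker_exchange]; monoidal
    _ = coaction C X ▷ Y ⊗≫ X ◁ (coendComul hC ▷ Y ≫ (C.pt ⊗ C.pt) ◁ coaction C Y) ⊗≫
        X ◁ (C.pt ◁ ((β_ C.pt (Y ⊗ C.pt)).hom ≫ (Y ◁ coendComul hC) ▷ C.pt) ⊗≫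
          (β_ C.pt (Y ⊗ C.pt)).hom ▷ (C.pt ⊗ C.pt) ⊗≫
          (Y ⊗ C.pt) ◁ coendPairing hC ▷ C.pt ⊗≫ (β_ (Y ⊗ C.pt) C.pt).hom) ⊗≫ 𝟙 _ := by
      rw [← coaction_coendComul hC, ← BraidedCategory.braiding_naturality_right]; monoidal
    _ = coaction C X ▷ Y ⊗≫ (X ⊗ C.pt) ◁ coaction C Y ⊗≫
        X ◁ (𝟙 (C.pt ⊗ (Y ⊗ C.pt)) ⊗≫ coendComul hC ▷ (Y ⊗ C.pt) ⊗≫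
          C.pt ◁ ((β_ C.pt (Y ⊗ C.pt)).hom ≫ (Y ◁ coendComul hC) ▷ C.pt) ⊗≫
          (β_ C.pt (Y ⊗ C.pt)).hom ▷ (C.pt ⊗ C.pt) ⊗≫
          (Y ⊗ C.pt) ◁ coendPairing hC ▷ C.pt ⊗≫ (β_ (Y ⊗ C.pt) C.pt).hom ⊗≫
            𝟙 ((C.pt ⊗ Y) ⊗ C.pt)) ⊗≫ 𝟙 _ := by
      rw [← whisker_exchange]; monoidal
    _ = _ := by
      rw [← coendTwist_crossing hC, tensorμ, tensorμ]; monoidal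

end CoendStructure

/-! ### Free modules and endomorphisms of the forgetful functor. -/

section Free

variable {V : Type u} [Category.{v} V] [MonoidalCategory V]

/-- The free right module on an object. -/
abbrev RightMod.free (X H : V) [MonObj H] : RightMod H where
  X := X ⊗ H
  act := (α_ X H H).hom ≫ X ◁ μ[H]
  act_one := by
    calc
      _ = 𝟙 _ ⊗≫ X ◁ (H ◁ η[H] ≫ μ[H]) := by monoidal
      _ = _ := by rw [MonObj.mul_one]; monoidal
  act_mul := by
    calc
      _ = 𝟙 _ ⊗≫ X ◁ ((α_ H H H).hom ≫ H ◁ μ[H] ≫ μ[H]) := by monoidal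
      _ = _ := by rw [← MonObj.mul_assoc]; monoidal

/-- The unit of the free right module on an object. -/
def RightMod.freeUnit (X H : V) [MonObj H] : X ⟶ X ⊗ H :=
  (ρ_ X).inv ≫ X ◁ η[H]

theorem RightMod.freeUnit_act (X H : V) [MonObj H] :
    RightMod.freeUnit X H ▷ H ≫ (RightMod.free X H).act = 𝟙 (X ⊗ H) := by
  change ((ρ_ X).inv ≫ X ◁ η[H]) ▷ H ≫ (α_ X H H).hom ≫ X ◁ μ[H] = _
  calc
    _ = 𝟙 _ ⊗≫ X ◁ (η[H] ▷ H ≫ μ[H]) := by monoidal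
    _ = _ := by rw [MonObj.one_mul]; monoidal

/-- The action of a module, as a morphism from the free module. -/
def RightMod.freeCounit {H : V} [MonObj H] (M : RightMod H) : RightMod.free M.X H ⟶ M :=
  ⟨M.act, by
    change ((α_ M.X H H).hom ≫ M.X ◁ μ[H]) ≫ M.act = _
    rw [Category.assoc, M.act_mul, Iso.hom_inv_id_assoc]⟩

theorem RightMod.freeUnit_freeCounit {H : V} [MonObj H] (M : RightMod H) :
    RightMod.freeUnit M.X H ≫ (RightMod.freeCounit M).hom = 𝟙 M.X := by
  change ((ρ_ M.X).inv ≫ M.X ◁ η[H]) ≫ M.act = _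
  rw [Category.assoc, M.act_one, Iso.inv_hom_id]

theorem RightMod.freeUnit_natural {X Y : V} (H : V) [MonObj H] (f : X ⟶ Y) :
    f ≫ RightMod.freeUnit Y H = RightMod.freeUnit X H ≫ f ▷ H := by
  change f ≫ (ρ_ Y).inv ≫ Y ◁ η[H] = ((ρ_ X).inv ≫ X ◁ η[H]) ≫ f ▷ H
  rw [Category.assoc, whisker_exchange, rightUnitor_inv_naturality_assoc]

/-- A morphism of free modules induced by a morphism of objects. -/
def RightMod.freeMap {X Y : V} (H : V) [MonObj H] (f : X ⟶ Y) :
    RightMod.free X H ⟶ RightMod.free Y H :=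
  ⟨f ▷ H, by
    change ((α_ X H H).hom ≫ X ◁ μ[H]) ≫ f ▷ H = f ▷ H ▷ H ≫ (α_ Y H H).hom ≫ Y ◁ μ[H]
    rw [Category.assoc, whisker_exchange, associator_naturality_left_assoc]⟩

/-- The natural family `X ⟶ X ⊗ H` whose component at `X` is the value at the unit of the
component of an endomorphism of the forgetful functor at the free module on `X`. -/
def flat {H : V} [MonObj H] (t : RightMod.forget H ⟶ RightMod.forget H) : 𝟭 V ⟶ tensorRight H where
  app X := RightMod.freeUnit X H ≫ t.app (RightMod.free X H)
  naturality X Y f := by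
    have h : f ▷ H ≫ t.app (RightMod.free Y H) = t.app (RightMod.free X H) ≫ f ▷ H :=
      t.naturality (RightMod.freeMap H f)
    have key : ∀ (a : X ⊗ H ⟶ X ⊗ H) (b : Y ⊗ H ⟶ Y ⊗ H), f ▷ H ≫ b = a ≫ f ▷ H →
        f ≫ RightMod.freeUnit Y H ≫ b = (RightMod.freeUnit X H ≫ a) ≫ f ▷ H := by
      intro a b hab
      rw [reassoc_of% (RightMod.freeUnit_natural H f), hab, Category.assoc]
    exact key _ _ h

/-- Naturality of `t` along the action `M ⊗ H ⟶ M`, a module morphism from a free module which the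
unit of `H` splits in `V`. -/
theorem sharp_flat {H : V} [MonObj H] (t : RightMod.forget H ⟶ RightMod.forget H) :
    sharp (flat t) = t := by
  ext M
  have h : (RightMod.freeCounit M).hom ≫ t.app M =
      t.app (RightMod.free M.X H) ≫ (RightMod.freeCounit M).hom :=
    t.naturality (RightMod.freeCounit M)
  have key : ∀ (a : M.X ⊗ H ⟶ M.X ⊗ H) (b : M.X ⟶ M.X),
      (RightMod.freeCounit M).hom ≫ b = a ≫ (RightMod.freeCounit M).hom →
        (RightMod.freeUnit M.X H ≫ a) ≫ (RightMod.freeCounit M).hom = b := by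
    intro a b hab
    rw [Category.assoc, ← hab, reassoc_of% (RightMod.freeUnit_freeCounit M)]
  exact key _ _ h

/-- Here naturality of `a` along the unit `X ⟶ X ⊗ H` is what is used. -/
theorem flat_sharp {H : V} [MonObj H] (a : 𝟭 V ⟶ tensorRight H) : flat (sharp a) = a := by
  ext X
  have h : RightMod.freeUnit X H ≫ a.app (RightMod.free X H).X =
      a.app X ≫ RightMod.freeUnit X H ▷ H := a.naturality (RightMod.freeUnit X H)
  change RightMod.freeUnit X H ≫ a.app (RightMod.free X H).X ≫ (RightMod.free X H).act = a.app X
  rw [reassoc_of% h, RightMod.freeUnit_act]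
  exact Category.comp_id _

theorem sharp_injective {H : V} [MonObj H] :
    Function.Injective (sharp (V := V) (H := H)) :=
  Function.LeftInverse.injective flat_sharp

end Free

/-! ### The bijection Σ, and the pivotal conditions as morphisms out of `C ⊗ H` and `C ⊗ C`. -/

section Sigma

variable {V : Type u} [Category.{v} V] [MonoidalCategory V] [RigidCategory V]
  {C : Limits.Cowedge (dualTensor V)} (hC : Limits.IsColimit C)

include hC in
theorem coendSigma_bijective (D : V) :
    Function.Bijective (fun p : C.pt ⟶ D => coendSigma C p) := by
  refine ⟨fun p q h => coend_hom_ext hC fun X => ?_, fun a => ?_⟩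
  · exact congrArg (fun t : 𝟭 V ⟶ tensorRight D => t.app X) h
  · refine ⟨coendDesc hC (fun X => a.app X) (fun f => a.naturality f), ?_⟩
    ext X
    exact coaction_coendDesc hC (fun X => a.app X) (fun f => a.naturality f) X

/-- On the free module over `X`, inserting the unit of `H` cancels the action, so the values on
modules recover `X ◁ f` after the coaction on `X`. -/
theorem free_hom_ext (hC : Limits.IsColimit C) {H : V} [MonObj H] {f g : C.pt ⊗ H ⟶ H}
    (h : ∀ M : RightMod H, coaction C M.X ▷ H ≫ (α_ M.X C.pt H).hom ≫ M.X ◁ f ≫ M.act =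
      coaction C M.X ▷ H ≫ (α_ M.X C.pt H).hom ≫ M.X ◁ g ≫ M.act) : f = g := by
  apply coendLift_hom_ext hC
  intro X
  have key : ∀ k : C.pt ⊗ H ⟶ H, coaction C X ▷ H ≫ (α_ X C.pt H).hom ≫ X ◁ k =
      RightMod.freeUnit X H ▷ H ≫ coaction C (RightMod.free X H).X ▷ H ≫
        (α_ (RightMod.free X H).X C.pt H).hom ≫ (RightMod.free X H).X ◁ k ≫
          (RightMod.free X H).act := by
    intro k
    rw [← comp_whiskerRight_assoc, coaction_natural, comp_whiskerRight_assoc,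
      associator_naturality_left_assoc, ← whisker_exchange_assoc, RightMod.freeUnit_act,
      Category.comp_id]
  rw [key, key, h]

/-- The component at a module of the endomorphism of the forgetful functor induced by `p`. -/
abbrev coendEndo (C : Limits.Cowedge (dualTensor V)) {H : V} [MonObj H] (p : C.pt ⟶ H)
    (M : RightMod H) : M.X ⟶ M.X :=
  (coaction C M.X ≫ M.X ◁ p) ≫ M.act

variable [BraidedCategory V]

/-- Naturality of the coaction along the action, followed by the formula for the coaction on `M ⊗
H`, exposes the left side of the square-of-antipode axiom. -/
theorem act_coendEndo {H : V} [MonObj H] (p : C.pt ⟶ H) (M : RightMod H) :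
    M.act ≫ coendEndo C p M = coaction C M.X ▷ H ≫ (α_ M.X C.pt H).hom ≫
      M.X ◁ (C.pt ◁ coaction C H ≫ (α_ C.pt H C.pt).inv ≫ (β_ C.pt H).hom ▷ C.pt ≫
        (α_ H C.pt C.pt).hom ≫ H ◁ (coendMul hC ≫ p) ≫ μ[H]) ≫ M.act := by
  rw [coendEndo, Category.assoc, reassoc_of% (coaction_natural C M.act), ← whisker_exchange_assoc,
    ← coaction_coendMul hC, tensorμ, MonoidalCategory.tensorHom_def]
  have e : M.act ▷ H ≫ M.act = (α_ M.X H H).hom ≫ M.X ◁ μ[H] ≫ M.act := by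
    rw [M.act_mul, Iso.hom_inv_id_assoc]
  rw [e]
  monoidal

/-- The double braiding is a coaction on `M` followed by `coendAct`. Together with the coaction in
`coendEndo` it gives a coproduct, hence the right side of the square-of-antipode axiom. -/
theorem doubleBraiding_antipode_coendEndo {H : V} [HopfObj H] (p : C.pt ⟶ H) (M : RightMod H) :
    (doubleBraiding M.X H ≫ M.X ◁ (𝒮[H] ≫ 𝒮[H])) ≫ coendEndo C p M ▷ H ≫ M.act =
      coaction C M.X ▷ H ≫ (α_ M.X C.pt H).hom ≫
        M.X ◁ ((coendComul hC ⊗ₘ (𝒮[H] ≫ 𝒮[H])) ≫ (α_ C.pt C.pt H).hom ≫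
          C.pt ◁ coendAct hC H ≫ p ▷ H ≫ μ[H]) ≫ M.act := by
  have e : M.act ▷ H ≫ M.act = (α_ M.X H H).hom ≫ M.X ◁ μ[H] ≫ M.act := by
    rw [M.act_mul, Iso.hom_inv_id_assoc]
  have h := doubleBraiding_natural (𝟙 M.X) (𝒮[H] ≫ 𝒮[H])
  rw [id_tensorHom] at h
  rw [← h, ← coaction_coendAct hC, coendEndo]
  simp only [comp_whiskerRight, Category.assoc, e]
  calc
    _ = (M.X ◁ (𝒮[H] ≫ 𝒮[H]) ≫ coaction C M.X ▷ H) ⊗≫ (M.X ◁ coendAct hC H ≫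
        coaction C M.X ▷ H) ⊗≫ M.X ◁ (p ▷ H ≫ μ[H]) ≫ M.act := by monoidal
    _ = (coaction C M.X ▷ H ≫ (M.X ⊗ C.pt) ◁ (𝒮[H] ≫ 𝒮[H])) ⊗≫
        coaction C M.X ▷ (C.pt ⊗ H) ⊗≫
        M.X ◁ C.pt ◁ coendAct hC H ⊗≫ M.X ◁ (p ▷ H ≫ μ[H]) ≫ M.act := by
      rw [whisker_exchange, whisker_exchange]; monoidal
    _ = coaction C M.X ▷ H ⊗≫ ((M.X ⊗ C.pt) ◁ (𝒮[H] ≫ 𝒮[H]) ≫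
        coaction C M.X ▷ C.pt ▷ H) ⊗≫
        M.X ◁ C.pt ◁ coendAct hC H ⊗≫ M.X ◁ (p ▷ H ≫ μ[H]) ≫ M.act := by
      monoidal
    _ = (coaction C M.X ≫ coaction C M.X ▷ C.pt ≫ (α_ M.X C.pt C.pt).hom) ▷ H ⊗≫
        M.X ◁ (C.pt ⊗ C.pt) ◁ (𝒮[H] ≫ 𝒮[H]) ⊗≫
        M.X ◁ C.pt ◁ coendAct hC H ⊗≫ M.X ◁ (p ▷ H ≫ μ[H]) ≫ M.act := by
      rw [whisker_exchange]; monoidal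
    _ = _ := by
      rw [← coaction_coendComul hC, MonoidalCategory.tensorHom_def]; monoidal

theorem coendEndo_tensor {H : V} [BimonObj H] (p : C.pt ⟶ H) (M N : RightMod H) :
    coendEndo C p (M ⊗ N) = (coaction C M.X ⊗ₘ coaction C N.X) ≫ tensorμ M.X C.pt N.X C.pt ≫
      (M.X ⊗ N.X) ◁ (coendMul hC ≫ p ≫ Δ[H]) ≫ tensorμ M.X N.X H H ≫ (M.act ⊗ₘ N.act) := by
  change (coaction C (M.X ⊗ N.X) ≫ (M.X ⊗ N.X) ◁ p) ≫ RightMod.diagAct M.act N.act = _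
  rw [← coaction_coendMul hC, RightMod.diagAct]
  simp only [MonoidalCategory.whiskerLeft_comp, Category.assoc]

theorem doubleBraiding_coendEndo {H : V} [BimonObj H] (p : C.pt ⟶ H) (M N : RightMod H) :
    doubleBraiding M.X N.X ≫ (coendEndo C p M ⊗ₘ coendEndo C p N) =
      (coaction C M.X ⊗ₘ coaction C N.X) ≫ tensorμ M.X C.pt N.X C.pt ≫
        (M.X ⊗ N.X) ◁ (coendTwist hC ≫ (p ⊗ₘ p)) ≫ tensorμ M.X N.X H H ≫
          (M.act ⊗ₘ N.act) := by
  rw [MonoidalCategory.whiskerLeft_comp, Category.assoc, tensorμ_natural_right_assoc,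
    reassoc_of% (coaction_coendTwist hC M.X N.X)]
  simp only [coendEndo, tensorHom_comp_tensorHom, Category.assoc]

/-- Again units of free modules cancel the actions; `tensorδ` then undoes the remaining shuffle
`tensorμ`. -/
theorem free_hom_ext₂ (hC : Limits.IsColimit C) {H : V} [MonObj H] {f g : C.pt ⊗ C.pt ⟶ H ⊗ H}
    (h : ∀ M N : RightMod H, (coaction C M.X ⊗ₘ coaction C N.X) ≫ tensorμ M.X C.pt N.X C.pt ≫
        (M.X ⊗ N.X) ◁ f ≫ tensorμ M.X N.X H H ≫ (M.act ⊗ₘ N.act) =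
      (coaction C M.X ⊗ₘ coaction C N.X) ≫ tensorμ M.X C.pt N.X C.pt ≫
        (M.X ⊗ N.X) ◁ g ≫ tensorμ M.X N.X H H ≫ (M.act ⊗ₘ N.act)) : f = g := by
  apply coendLift₂_hom_ext hC
  intro X Y
  have key : ∀ k : C.pt ⊗ C.pt ⟶ H ⊗ H, (coaction C X ⊗ₘ coaction C Y) ≫
      tensorμ X C.pt Y C.pt ≫ (X ⊗ Y) ◁ k =
      (RightMod.freeUnit X H ⊗ₘ RightMod.freeUnit Y H) ≫
        ((coaction C (RightMod.free X H).X ⊗ₘ coaction C (RightMod.free Y H).X) ≫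
          tensorμ (RightMod.free X H).X C.pt (RightMod.free Y H).X C.pt ≫
          ((RightMod.free X H).X ⊗ (RightMod.free Y H).X) ◁ k ≫
          tensorμ (RightMod.free X H).X (RightMod.free Y H).X H H ≫
          ((RightMod.free X H).act ⊗ₘ (RightMod.free Y H).act)) ≫ tensorδ X Y H H := by
    intro k
    have hn : (RightMod.freeUnit X H ▷ C.pt ⊗ₘ RightMod.freeUnit Y H ▷ C.pt) ≫
        tensorμ (RightMod.free X H).X C.pt (RightMod.free Y H).X C.pt =
        tensorμ X C.pt Y C.pt ≫
          (RightMod.freeUnit X H ⊗ₘ RightMod.freeUnit Y H) ▷ (C.pt ⊗ C.pt) := by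
      have := tensorμ_natural (RightMod.freeUnit X H) (𝟙 C.pt) (RightMod.freeUnit Y H) (𝟙 C.pt)
      simpa using this
    simp only [Category.assoc]
    rw [tensorHom_comp_tensorHom_assoc, coaction_natural, coaction_natural,
      ← tensorHom_comp_tensorHom_assoc, reassoc_of% hn, ← whisker_exchange_assoc,
      tensorμ_natural_left_assoc, tensorHom_comp_tensorHom_assoc, RightMod.freeUnit_act,
      RightMod.freeUnit_act, id_tensorHom_id]
    simp
  rw [key, key, h]

theorem coendEndo_unit {H : V} [BimonObj H] (p : C.pt ⟶ H) :
    coendEndo C p (𝟙_ (RightMod H)) = coendUnit C ≫ p ≫ ε[H] := by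
  change (coaction C (𝟙_ V) ≫ 𝟙_ V ◁ p) ≫ (λ_ H).hom ≫ ε[H] = _
  simp [coendUnit]

end Sigma

/-! ### Each pivotal condition is equivalent to one axiom on `p`. -/

section CPivotal

variable {V : Type u} [Category.{v} V] [MonoidalCategory V] [BraidedCategory V]

/-- The double braiding and S² commute with `f`, so the isomorphism `d` can be cancelled, leaving a
condition on `f` alone. -/
theorem linear_comp_iff {H : V} [HopfObj H] {X Z : V} (d : X ⟶ Z) [IsIso d] (r : X ⊗ H ⟶ X)
    (s : Z ⊗ H ⟶ Z)
    (h : d ▷ H ≫ s = (doubleBraiding X H ≫ X ◁ (𝒮[H] ≫ 𝒮[H]) ≫ r) ≫ d) (f : X ⟶ X) :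
    r ≫ f ≫ d = (f ≫ d) ▷ H ≫ s ↔
      r ≫ f = (doubleBraiding X H ≫ X ◁ (𝒮[H] ≫ 𝒮[H])) ≫ f ▷ H ≫ r := by
  have hn := doubleBraiding_natural f (𝟙 H)
  rw [tensorHom_id] at hn
  have e : (f ≫ d) ▷ H ≫ s =
      ((doubleBraiding X H ≫ X ◁ (𝒮[H] ≫ 𝒮[H])) ≫ f ▷ H ≫ r) ≫ d := by
    rw [comp_whiskerRight, Category.assoc, h]
    simp only [Category.assoc]
    rw [reassoc_of% hn, ← whisker_exchange_assoc]
  rw [e, ← Category.assoc, cancel_mono]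

/-- The monoidality defect of the Drinfeld isomorphism is moved onto the endomorphisms by naturality
of the double braiding. -/
theorem comp_tensor_iff {X₁ X₂ Z₁ Z₂ W : V} (d : X₁ ⊗ X₂ ⟶ W) (e : W ⟶ Z₁ ⊗ Z₂) (m₁ : X₁ ⟶ Z₁)
    (m₂ : X₂ ⟶ Z₂) [IsIso m₁] [IsIso m₂] (h : doubleBraiding X₁ X₂ ≫ d ≫ e = (m₁ ⊗ₘ m₂))
    (a : X₁ ⊗ X₂ ⟶ X₁ ⊗ X₂) (f₁ : X₁ ⟶ X₁) (f₂ : X₂ ⟶ X₂) :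
    (a ≫ d) ≫ e = (f₁ ≫ m₁ ⊗ₘ f₂ ≫ m₂) ↔ a = doubleBraiding X₁ X₂ ≫ (f₁ ⊗ₘ f₂) := by
  have h' : d ≫ e = inv (doubleBraiding X₁ X₂) ≫ (m₁ ⊗ₘ m₂) := by
    rw [← h, IsIso.inv_hom_id_assoc]
  rw [Category.assoc, h', ← tensorHom_comp_tensorHom, ← Category.assoc, cancel_mono,
    IsIso.comp_inv_eq, doubleBraiding_natural]

variable [RigidCategory V] {C : Limits.Cowedge (dualTensor V)} (hC : Limits.IsColimit C) {H : V}
  [HopfObj H]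

theorem coendEndo_linear_iff (p : C.pt ⟶ H) :
    (∀ M : RightMod H, M.act ≫ coendEndo C p M ≫ drinfeld M.X =
      (coendEndo C p M ≫ drinfeld M.X) ▷ H ≫ ((doubleDual (RightMod H)).obj M).act) ↔
    C.pt ◁ coaction C H ≫ (α_ C.pt H C.pt).inv ≫ (β_ C.pt H).hom ▷ C.pt ≫ (α_ H C.pt C.pt).hom ≫
      H ◁ (coendMul hC ≫ p) ≫ μ[H] =
    (coendComul hC ⊗ₘ (𝒮[H] ≫ 𝒮[H])) ≫ (α_ C.pt C.pt H).hom ≫ C.pt ◁ coendAct hC H ≫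
      p ▷ H ≫ μ[H] := by
  have key (M : RightMod H) := linear_comp_iff (drinfeld M.X) M.act
    -- The action on the double dual module is `dualAct` applied twice by definition.
    ((doubleDual (RightMod H)).obj M).act (by
      rw [drinfeld_eq_drinfeldIso_hom]
      exact drinfeldIso_dualAct M.X (ᘁM.X : V) (ᘁ(ᘁM.X) : V) M.act) (coendEndo C p M)
  refine (forall_congr' key).trans ?_
  simp only [act_coendEndo hC, doubleBraiding_antipode_coendEndo hC]
  exact ⟨free_hom_ext hC, fun h M => by rw [h]⟩

theorem coendEndo_tensor_iff (p : C.pt ⟶ H) :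
    (∀ M N : RightMod H, (coendEndo C p (M ⊗ N) ≫ drinfeld (M ⊗ N).X) ≫
      (doubleDualTensorIso M N).hom.hom =
        (coendEndo C p M ≫ drinfeld M.X ⊗ₘ coendEndo C p N ≫ drinfeld N.X)) ↔
    coendMul hC ≫ p ≫ Δ[H] = coendTwist hC ≫ (p ⊗ₘ p) := by
  have key (M N : RightMod H) := comp_tensor_iff (drinfeld (M.X ⊗ N.X))
    (doubleDualTensorIso M.X N.X).hom (drinfeld M.X) (drinfeld N.X)
    (doubleBraiding_drinfeld_tensor M.X N.X) (coendEndo C p (M ⊗ N)) (coendEndo C p M)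
    (coendEndo C p N)
  refine (forall_congr' fun M => forall_congr' (key M)).trans ?_
  simp only [coendEndo_tensor hC, doubleBraiding_coendEndo hC]
  exact ⟨free_hom_ext₂ hC, fun h M N => by rw [h]⟩

theorem coendEndo_unit_iff (p : C.pt ⟶ H) :
    (coendEndo C p (𝟙_ (RightMod H)) ≫ drinfeld (𝟙_ (RightMod H)).X) ≫
      (doubleDualUnitIso (RightMod H)).hom.hom = 𝟙 (𝟙_ V) ↔
    coendUnit C ≫ p ≫ ε[H] = 𝟙 (𝟙_ V) := by
  have key : ∀ f : 𝟙_ V ⟶ 𝟙_ V, (f ≫ drinfeld (𝟙_ V)) ≫ (doubleDualUnitIso V).hom = f := by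
    intro f
    rw [Category.assoc, drinfeld_unit, Category.comp_id]
  rw [← coendEndo_unit]
  exact Eq.congr_left (key (coendEndo C p (𝟙_ (RightMod H))))

/-- The pivotal structure associated with a `C`-pivotal element. -/
def IsCPivotal.pivotalStructure {p : C.pt ⟶ H} (hp : IsCPivotal hC p) :
    PivotalStructure (RightMod H) where
  toNatTrans :=
    { app := fun M => ⟨coendEndo C p M ≫ drinfeld M.X,
        (coendEndo_linear_iff hC p).2 hp.antipode_sq M⟩
      naturality := fun M N f => by
        have h : f.hom ≫ coendEndo C p N = coendEndo C p M ≫ f.hom :=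
          (sharp (coendSigma C p)).naturality f
        refine RightMod.hom_ext ?_
        change f.hom ≫ coendEndo C p N ≫ drinfeld N.X =
          (coendEndo C p M ≫ drinfeld M.X) ≫ (doubleDual V).map f.hom
        rw [Category.assoc (coendEndo C p M), ← drinfeld_natural, ← Category.assoc, h,
          Category.assoc] }
  tensor M N := RightMod.hom_ext ((coendEndo_tensor_iff hC p).2 hp.comul M N)
  unit := RightMod.hom_ext ((coendEndo_unit_iff p).2 hp.counit)

theorem IsCPivotal.of_pivotalStructure (φ : PivotalStructure (RightMod H)) {p : C.pt ⟶ H}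
    (h : ∀ M, (φ.toNatTrans.app M).hom = coendEndo C p M ≫ drinfeld M.X) : IsCPivotal hC p where
  comul := (coendEndo_tensor_iff hC p).1 fun M N => by
    have := congrArg RightMod.Hom.hom (φ.tensor M N)
    change (φ.toNatTrans.app (M ⊗ N)).hom ≫ _ =
      ((φ.toNatTrans.app M).hom ⊗ₘ (φ.toNatTrans.app N).hom) at this
    rw [h, h, h] at this
    exact this
  counit := (coendEndo_unit_iff p).1 (by
    have := congrArg RightMod.Hom.hom φ.unit
    change (φ.toNatTrans.app (𝟙_ (RightMod H))).hom ≫ _ = 𝟙 (𝟙_ V) at this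
    rw [h] at this
    exact this)
  antipode_sq := (coendEndo_linear_iff hC p).1 fun M => by
    have := (φ.toNatTrans.app M).linear
    rw [h] at this
    exact this

/-- The endomorphism of the forgetful functor obtained from a natural transformation to the double
dual functor by composing with the inverses of the Drinfeld isomorphisms. -/
noncomputable def forgetEndo (φ : 𝟭 (RightMod H) ⟶ doubleDual (RightMod H)) :
    RightMod.forget H ⟶ RightMod.forget H where
  app M := CategoryStruct.comp (X := M.X) (Y := (doubleDual V).obj M.X) (Z := M.X)
    (φ.app M).hom (inv (drinfeld M.X))
  naturality M N f := by
    have key : ∀ (a : M.X ⟶ (doubleDual V).obj M.X) (b : N.X ⟶ (doubleDual V).obj N.X),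
        f.hom ≫ b = a ≫ (doubleDual V).map f.hom →
          f.hom ≫ b ≫ inv (drinfeld N.X) = (a ≫ inv (drinfeld M.X)) ≫ f.hom := by
      intro a b hab
      rw [reassoc_of% hab, Category.assoc, ← cancel_mono (drinfeld N.X)]
      simp only [Category.assoc, IsIso.inv_hom_id, Category.comp_id]
      rw [drinfeld_natural, IsIso.inv_hom_id_assoc]
    exact key _ _ (congrArg RightMod.Hom.hom (φ.naturality f))

end CPivotal

/-! ### The main theorem. -/

theorem mainTheorem1 {V : Type u} [Category.{v} V] [MonoidalCategory V] [BraidedCategory V]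
    [RigidCategory V] (C : Limits.Cowedge (dualTensor V)) (hC : Limits.IsColimit C)
    (H : V) [HopfObj H] :
    Function.Bijective (fun p : C.pt ⟶ H => coendSigma C p) ∧
    ∃ e : {p : C.pt ⟶ H // IsCPivotal hC p} ≃ PivotalStructure (RightMod H),
      ∀ (p : {p : C.pt ⟶ H // IsCPivotal hC p}) (M : RightMod H),
        ((e p).toNatTrans.app M).hom =
          (sharp (coendSigma C p.1)).app M ≫ drinfeld M.X := by
  refine ⟨coendSigma_bijective hC H, Equiv.ofBijective
    (fun p => p.2.pivotalStructure) ⟨?_, ?_⟩, fun p M => rfl⟩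
  · intro p q h
    apply Subtype.ext
    apply (coendSigma_bijective hC H).1
    apply sharp_injective
    ext M
    have hM : coendEndo C p.1 M ≫ drinfeld M.X = coendEndo C q.1 M ≫ drinfeld M.X :=
      congrArg (fun φ : PivotalStructure (RightMod H) => (φ.toNatTrans.app M).hom) h
    exact (cancel_mono (drinfeld M.X)).1 hM
  · intro φ
    -- The preimage `p` is read off from φ followed by μ⁻¹, evaluated on free modules at the unit of
    -- `H`.
    obtain ⟨p, hp⟩ := (coendSigma_bijective hC H).2 (flat (forgetEndo φ.toNatTrans))
    have hφ : ∀ M, (φ.toNatTrans.app M).hom = coendEndo C p M ≫ drinfeld M.X := by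
      intro M
      have hM : coendEndo C p M = CategoryStruct.comp (X := M.X) (Y := (doubleDual V).obj M.X)
          (Z := M.X) (φ.toNatTrans.app M).hom (inv (drinfeld M.X)) :=
        congrArg (fun t : RightMod.forget H ⟶ RightMod.forget H => t.app M)
          ((congrArg sharp hp).trans (sharp_flat (forgetEndo φ.toNatTrans)))
      exact ((IsIso.eq_comp_inv (drinfeld M.X)).1 hM).symm
    refine ⟨⟨p, .of_pivotalStructure hC φ hφ⟩, ?_⟩
    apply PivotalStructure.ext
    ext M
    exact (hφ M).symm
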